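/- Let $R=\mathbb{Z}[t]/(t^4)$. For $k\ge 1$ let $a_R(k)$ be the number of subrings $S$ of $R$ (containing $1$) with $[R:S]=k$; this number is finite. Let $\zeta_R(s)=\sum_{k\ge1}a_R(k)k^{-s}$ be the subring zeta function of $R$ and, for a prime $p$, let $\zeta_{R,p}(s)=\sum_{l\ge0}a_R(p^l)p^{-ls}$. Let $s_R(B)=\sum_{k\le B}a_R(k)$ be the number of subrings of index at most $B$. The series $\zeta_R(s)$ converges absolutely for $\Re s>3/2$, where $\zeta_R(s)=\prod_p\zeta_{R,p}(s)$, the product being over all primes and converging unconditionally. For $\Re s>1$ the local series converge absolutely and, with $x=p^{-s}$, for $p$ odd $$\zeta_{R,p}(s)=\frac{1+px^2+p^2x^3-p^4x^5-2p^5x^6-2p^6x^7-p^7x^8+p^9x^{10}+p^{10}x^{11}+p^{11}x^{13}}{(1-p^5x^6)(1-p^4x^4)(1-p^3x^3)(1-p^2x^2)(1-x)},$$ while for $p=2$, with $x=2^{-s}$, $$\zeta_{R,2}(s)=\frac{1+2x^2+2^2x^3-2^4x^5-(2^7+2^6)x^7-2^7x^8+2^9x^{10}+2^{10}x^{11}-2^{11}x^{12}+2^{12}x^{13}}{(1-2^5x^6)(1-2^4x^4)(1-2^3x^3)(1-2^2x^2)(1-x)}.$$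 For some $\delta>0$ the function $\zeta_R(s)$ has a meromorphic continuation to the half-plane $\Re s>3/2-\delta$ whose only pole there is a simple pole at $s=3/2$; so the rightmost pole of $\zeta_R(s)$ is a simple pole at $s=3/2$. Finally $s_R(B)\sim C\,B^{3/2}$ as $B\to\infty$, where $$C=\frac{314-5\sqrt2}{768}\,\zeta\!\left(\tfrac32\right)^2\zeta(2)\,\zeta(4)\prod_{p\ne2}\left(1+p^{-2}+p^{-5/2}-p^{-7/2}-2p^{-4}-2p^{-9/2}-p^{-5}+p^{-6}+p^{-13/2}+p^{-17/2}\right),$$ $\zeta$ being the Riemann zeta function, and the product over the odd primes converges unconditionally. -/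

import Mathlib

/-- The ring `ℤ[t]/(t⁴)`. -/
abbrev ZtModT4 : Type :=
  Polynomial ℤ ⧸ Ideal.span {(Polynomial.X : Polynomial ℤ) ^ 4}

/-- The set of (unital) subrings `S` of `R` with `[R : S] = k`. For `k ≠ 0` the index of additive
groups in Mathlib takes the value `k` exactly on the subgroups whose index is finite and equal
to `k`. -/
def subringsOfIndex (R : Type*) [Ring R] (k : ℕ) : Set (Subring R) :=
  {S | S.toAddSubgroup.index = k}

/-- `a_R(k)`, the number of subrings of index `k`. -/
noncomputable def subringCount (R : Type*) [Ring R] (k : ℕ) : ℕ :=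
  (subringsOfIndex R k).ncard

/-- The subring zeta function `ζ_R(s) = ∑_{k ≥ 1} a_R(k) / k ^ s`. -/
noncomputable def subringZeta (R : Type*) [Ring R] (s : ℂ) : ℂ :=
  LSeries (fun k => (subringCount R k : ℂ)) s

/-- The general term `a_R(p ^ l) / p ^ (l s)` of the local series at `p`. -/
noncomputable def subringZetaLocalTerm (R : Type*) [Ring R] (p : ℕ) (s : ℂ) (l : ℕ) : ℂ :=
  (subringCount R (p ^ l) : ℂ) / ((p ^ l : ℕ) : ℂ) ^ s

/-- The local factor `ζ_{R,p}(s) = ∑_{l ≥ 0} a_R(p ^ l) / p ^ (l s)`. -/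
noncomputable def subringZetaLocal (R : Type*) [Ring R] (p : ℕ) (s : ℂ) : ℂ :=
  ∑' l : ℕ, subringZetaLocalTerm R p s l

/-- `s_R(B) = ∑_{1 ≤ k ≤ B} a_R(k)`, the number of subrings of index at most `B`. -/
noncomputable def subringCountUpTo (R : Type*) [Ring R] (B : ℝ) : ℕ :=
  ∑ k ∈ Finset.Icc 1 ⌊B⌋₊, subringCount R k

/-- The factor at `p` of the Euler product in the leading constant. -/
noncomputable def constantFactor (p : ℝ) : ℝ :=
  1 + p ^ (-2 : ℝ) + p ^ (-(5 / 2) : ℝ) - p ^ (-(7 / 2) : ℝ) - 2 * p ^ (-4 : ℝ)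
    - 2 * p ^ (-(9 / 2) : ℝ) - p ^ (-5 : ℝ) + p ^ (-6 : ℝ) + p ^ (-(13 / 2) : ℝ)
    + p ^ (-(17 / 2) : ℝ)

/-!
A subring of finite index in `ℤ[t]/(t⁴)` contains `1`, so it is determined by its elements without
constant term, a lattice with a unique Hermite basis `a t + b t² + c t³`, `d t² + e t³`, `f t³`.
Closure under multiplication amounts to `d ∣ a²`, `f ∣ a d` and `f ∣ 2 a b - (a² / d) e`
(`exists_hermiteSubring`, `hermiteSubring_inj`), and the index is `a d f`. The last condition is a
linear congruence in `b` and `e` with `d gcd(2 a, a² / d, f)` solutions, and `c` is free, so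
`a_R(k)` is the sum of `d f gcd(2 a, a² / d, f)` over the factorizations `k = a d f` with `d ∣ a²`
and `f ∣ a d` (`subringCount_eq`). This expression is multiplicative in `k`
(`isMultiplicative_subringArith`).

For `k` a power of `p` the sum runs over exponents `(n, j, l)` of `(a, d, f)` with `j ≤ 2 n` and
`l ≤ n + j`. For fixed `n` the inner double sum is, up to a common denominator not depending on `n`,
a combination of the `n`-th powers of `x`, `p² x²`, `p³ x³`, `p⁴ x⁴`, `p⁵ x⁶`
(`exists_sum_eq_combination`). Summing over `n` gives the rational expression for the generating
function, as an identity of formal power series (`localSeries_mul_localDenominator`). The prime `2`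
is special only because of the factor `2` in `gcd(2 a, a² / d, f)`, which enters through `valTwo`.

Since all monomials other than `1` in the numerator are of the form `pⁱ xʲ` with `1 ≤ i < j`, the
factor `(1 - p² x²)⁻¹` is responsible for the first singularity. Removing it from every local factor
leaves a Dirichlet series, that of `reducedArith`, converging absolutely for `Re s > 4/3`
(`LSeriesSummable_reducedArith`), and `ζ_R(s) = ζ(2 s - 2) ∑ reducedArith(n) n ^ (-s)`
(`subringZeta_eq`). The right-hand side is the continuation to `Re s > 4/3`; its only pole is that
of `ζ(2 s - 2)` at `s = 3/2`, because the second factor does not vanish there: by its Euler product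
it equals `3 (314 - 5 √2) / 768` times zeta values and a product of factors `constantFactor p ≥ 1`
(`LSeries_reducedArith_eq`).

For the asymptotics no Tauberian theorem is needed. The factorization writes `a_R` as the
convolution of `reducedArith` with the indicator of squares weighted by `m²`, so that
`s_R(B) = ∑ reducedArith(n) Q(B / n)` with `Q(y)` the sum of the squares up to `y`. As
`Q(y) ∼ y ^ (3/2) / 3` and `0 ≤ Q(y) ≤ y ^ (3/2)`, dominated convergence gives
`s_R(B) / B ^ (3/2) → (1/3) ∑ reducedArith(n) n ^ (-3/2)` (`tendsto_subringCountUpTo_div`).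
-/

/-! ### Arithmetic in `ℤ[t]/(t⁴)` -/

namespace ZtModT4

open Polynomial in
/-- The element `n + x t + y t² + z t³` of `ℤ[t]/(t⁴)`. -/
noncomputable def elt (n x y z : ℤ) : ZtModT4 :=
  Ideal.Quotient.mk _ (C n + C x * X + C y * X ^ 2 + C z * X ^ 3)

open Polynomial in
theorem elt_inj {n x y z n' x' y' z' : ℤ} :
    elt n x y z = elt n' x' y' z' ↔ n = n' ∧ x = x' ∧ y = y' ∧ z = z' := by
  constructor
  · intro h
    have h2 := Ideal.mem_span_singleton.1 (Ideal.Quotient.eq.1 h)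
    rw [X_pow_dvd_iff] at h2
    have h0 := h2 0 (by norm_num)
    have h1 := h2 1 (by norm_num)
    have h3 := h2 2 (by norm_num)
    have h4 := h2 3 (by norm_num)
    simp [coeff_X, coeff_X_pow, coeff_C, -eq_intCast] at h0 h1 h3 h4
    omega
  · rintro ⟨rfl, rfl, rfl, rfl⟩; rfl

open Polynomial in
theorem exists_elt (r : ZtModT4) : ∃ n x y z, r = elt n x y z := by
  obtain ⟨q, rfl⟩ := Ideal.Quotient.mk_surjective r
  refine ⟨q.coeff 0, q.coeff 1, q.coeff 2, q.coeff 3, ?_⟩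
  rw [elt, Ideal.Quotient.eq, Ideal.mem_span_singleton, X_pow_dvd_iff]
  intro d hd
  interval_cases d <;> simp [coeff_X, coeff_X_pow, coeff_C, -eq_intCast]

theorem elt_add (n x y z n' x' y' z' : ℤ) :
    elt n x y z + elt n' x' y' z' = elt (n + n') (x + x') (y + y') (z + z') := by
  simp only [elt, ← map_add]
  congr 1
  simp only [Polynomial.C_add]
  ring

theorem elt_neg (n x y z : ℤ) : -elt n x y z = elt (-n) (-x) (-y) (-z) := by
  simp only [elt, ← map_neg]
  congr 1
  simp only [Polynomial.C_neg]
  ring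

theorem elt_sub (n x y z n' x' y' z' : ℤ) :
    elt n x y z - elt n' x' y' z' = elt (n - n') (x - x') (y - y') (z - z') := by
  rw [sub_eq_add_neg, elt_neg, elt_add]; rfl

theorem elt_zero : elt 0 0 0 0 = 0 := by simp [elt]

theorem elt_one : elt 1 0 0 0 = 1 := by simp [elt]

open Polynomial in
theorem elt_mul (n x y z n' x' y' z' : ℤ) :
    elt n x y z * elt n' x' y' z' = elt (n * n') (n * x' + x * n')
      (n * y' + x * x' + y * n') (n * z' + x * y' + y * x' + z * n') := by
  simp only [elt, ← map_mul]
  rw [Ideal.Quotient.eq, Ideal.mem_span_singleton]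
  refine ⟨C (x * z' + y * y' + z * x') + C (y * z' + z * y') * X + C (z * z') * X ^ 2, ?_⟩
  simp only [C_add, C_mul]
  ring

theorem zsmul_elt (m n x y z : ℤ) : m • elt n x y z = elt (m * n) (m * x) (m * y) (m * z) := by
  have h : ((m : ℤ) : ZtModT4) = elt m 0 0 0 := by simp [elt]
  rw [zsmul_eq_mul, h, elt_mul]
  simp

theorem elt_const_mem (S : Subring ZtModT4) (n : ℤ) : elt n 0 0 0 ∈ S := by
  have h : ((n : ℤ) : ZtModT4) = elt n 0 0 0 := by simp [elt]
  exact h ▸ intCast_mem S n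

theorem elt_mem_iff (S : Subring ZtModT4) (n x y z : ℤ) :
    elt n x y z ∈ S ↔ elt 0 x y z ∈ S := by
  have h : elt n x y z = elt n 0 0 0 + elt 0 x y z := by simp [elt_add]
  rw [h]
  exact S.toAddSubgroup.add_mem_cancel_left (elt_const_mem S n)

/-! ### Subrings in Hermite normal form -/

/-- The conditions on the Hermite basis `a t + b t² + c t³`, `d t² + e t³`, `f t³` which make the
lattice spanned by it closed under multiplication. The division in the last condition is exact by
the first one. -/
def IsClosedForm (a b d e f : ℕ) : Prop :=
  d ∣ a ^ 2 ∧ f ∣ a * d ∧ (f : ℤ) ∣ (2 * a : ℕ) * b - (a ^ 2 / d : ℕ) * e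

/-- The subring of `ℤ[t]/(t⁴)` with `ℤ`-basis `1`, `a t + b t² + c t³`, `d t² + e t³`, `f t³`. -/
noncomputable def hermiteSubring (a b c d e f : ℕ) (h : IsClosedForm a b d e f) :
    Subring ZtModT4 where
  carrier := {r | ∃ n i j k : ℤ, r = elt n (i * a) (i * b + j * d) (i * c + j * e + k * f)}
  zero_mem' := ⟨0, 0, 0, 0, by simp [elt_zero]⟩
  one_mem' := ⟨1, 0, 0, 0, by simp [elt_one]⟩
  add_mem' := by
    rintro _ _ ⟨n, i, j, k, rfl⟩ ⟨n', i', j', k', rfl⟩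
    refine ⟨n + n', i + i', j + j', k + k', ?_⟩
    rw [elt_add, elt_inj]
    refine ⟨rfl, ?_, ?_, ?_⟩ <;> ring
  neg_mem' := by
    rintro _ ⟨n, i, j, k, rfl⟩
    refine ⟨-n, -i, -j, -k, ?_⟩
    rw [elt_neg, elt_inj]
    refine ⟨rfl, ?_, ?_, ?_⟩ <;> ring
  mul_mem' := by
    rintro _ _ ⟨n, i, j, k, rfl⟩ ⟨n', i', j', k', rfl⟩
    obtain ⟨h1, ⟨m', hm'⟩, ⟨m, hm⟩⟩ := h
    have h1' : (a : ℤ) ^ 2 = d * (a ^ 2 / d : ℕ) := by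
      exact_mod_cast (Nat.mul_div_cancel' h1).symm
    have hm'' : (a : ℤ) * d = f * m' := by exact_mod_cast hm'
    generalize ((a ^ 2 / d : ℕ) : ℤ) = q at *
    push_cast at hm
    refine ⟨n * n', n * i' + n' * i, n * j' + n' * j + i * i' * q,
      n * k' + n' * k + i * i' * m + m' * (i * j' + i' * j), ?_⟩
    rw [elt_mul, elt_inj]
    refine ⟨rfl, by ring, ?_, ?_⟩
    · linear_combination (i * i') * h1'
    · linear_combination (i * j' + i' * j) * hm'' + i * i' * hm

theorem elt_mem_hermiteSubring {a b c d e f : ℕ} {h : IsClosedForm a b d e f} {n x y z : ℤ} :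
    elt n x y z ∈ hermiteSubring a b c d e f h ↔
      ∃ i j k : ℤ, x = i * a ∧ y = i * b + j * d ∧ z = i * c + j * e + k * f := by
  constructor
  · rintro ⟨n', i, j, k, hr⟩
    rw [elt_inj] at hr
    exact ⟨i, j, k, hr.2⟩
  · rintro ⟨i, j, k, h1, h2, h3⟩
    exact ⟨n, i, j, k, by rw [h1, h2, h3]⟩

theorem eq_zero_of_mul_eq_sub {m i : ℤ} {u v : ℕ} (hu : (u : ℤ) < m) (hv : (v : ℤ) < m)
    (h : (u : ℤ) - v = i * m) : i = 0 := by
  by_contra hi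
  rcases lt_or_gt_of_ne hi with h' | h' <;> nlinarith

theorem index_hermiteSubring {a b c d e f : ℕ} (h : IsClosedForm a b d e f) (ha : 0 < a)
    (hd : 0 < d) (hf : 0 < f) :
    (hermiteSubring a b c d e f h).toAddSubgroup.index = a * d * f := by
  set S := hermiteSubring a b c d e f h
  -- the elements with reduced coordinates form a system of representatives
  let φ : Fin a × Fin d × Fin f → ZtModT4 ⧸ S.toAddSubgroup := fun u =>
    QuotientAddGroup.mk (elt 0 (u.1 : ℕ) (u.2.1 : ℕ) (u.2.2 : ℕ))
  have hφ : Function.Bijective φ := by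
    constructor
    · rintro ⟨x, y, z⟩ ⟨x', y', z'⟩ hxy
      have h1 := QuotientAddGroup.eq.1 hxy
      dsimp only at h1
      rw [elt_neg, elt_add] at h1
      obtain ⟨i, j, k, h1, h2, h3⟩ := (elt_mem_hermiteSubring (h := h)).1 h1
      have hi : i = 0 := eq_zero_of_mul_eq_sub (u := x') (v := x) (m := a)
        (by exact_mod_cast x'.2) (by exact_mod_cast x.2) (by linarith)
      subst hi
      have hj : j = 0 := eq_zero_of_mul_eq_sub (u := y') (v := y) (m := d)
        (by exact_mod_cast y'.2) (by exact_mod_cast y.2) (by linarith)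
      subst hj
      have hk : k = 0 := eq_zero_of_mul_eq_sub (u := z') (v := z) (m := f)
        (by exact_mod_cast z'.2) (by exact_mod_cast z.2) (by linarith)
      subst hk
      simp only [Prod.mk.injEq, Fin.ext_iff]
      refine ⟨?_, ?_, ?_⟩ <;> omega
    · intro q
      obtain ⟨r, rfl⟩ := QuotientAddGroup.mk_surjective q
      obtain ⟨n, x, y, z, rfl⟩ := exists_elt r
      have ha' : (0 : ℤ) < a := by exact_mod_cast ha
      have hd' : (0 : ℤ) < d := by exact_mod_cast hd
      have hf' : (0 : ℤ) < f := by exact_mod_cast hf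
      set i := x / a with hi
      set j := (y - i * b) / d with hj
      set k := (z - i * c - j * e) / f with hk
      have e1 := Int.emod_add_mul_ediv x a
      have e2 := Int.emod_add_mul_ediv (y - i * b) d
      have e3 := Int.emod_add_mul_ediv (z - i * c - j * e) f
      have n1 := Int.emod_nonneg x ha'.ne'
      have n2 := Int.emod_nonneg (y - i * b) hd'.ne'
      have n3 := Int.emod_nonneg (z - i * c - j * e) hf'.ne'
      have l1 := Int.emod_lt_of_pos x ha'
      have l2 := Int.emod_lt_of_pos (y - i * b) hd'
      have l3 := Int.emod_lt_of_pos (z - i * c - j * e) hf'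
      rw [← hi] at e1
      rw [← hj] at e2
      rw [← hk] at e3
      obtain ⟨u, hu⟩ := Int.eq_ofNat_of_zero_le n1
      obtain ⟨v, hv⟩ := Int.eq_ofNat_of_zero_le n2
      obtain ⟨w, hw⟩ := Int.eq_ofNat_of_zero_le n3
      rw [hu] at e1 l1
      rw [hv] at e2 l2
      rw [hw] at e3 l3
      refine ⟨⟨⟨u, by omega⟩, ⟨v, by omega⟩, ⟨w, by omega⟩⟩, ?_⟩
      refine QuotientAddGroup.eq.2 ?_
      simp only
      rw [elt_neg, elt_add]
      refine (elt_mem_hermiteSubring (h := h)).2 ⟨i, j, k, by linarith, by linarith, by linarith⟩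
  rw [AddSubgroup.index, ← Nat.card_congr (Equiv.ofBijective φ hφ)]
  simp [mul_assoc]

/-- A subring determines its Hermite normal form, provided the entries above the diagonal are
reduced. -/
theorem hermiteSubring_inj {a b c d e f a' b' c' d' e' f' : ℕ} {h : IsClosedForm a b d e f}
    {h' : IsClosedForm a' b' d' e' f'} (ha : 0 < a)
    (hd : 0 < d) (hb : b < d) (hc : c < f) (he : e < f) (ha' : 0 < a')
    (hd' : 0 < d') (hb' : b' < d') (hc' : c' < f') (he' : e' < f')
    (hS : hermiteSubring a b c d e f h = hermiteSubring a' b' c' d' e' f' h') :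
    a = a' ∧ b = b' ∧ c = c' ∧ d = d' ∧ e = e' ∧ f = f' := by
  have key : ∀ x y z : ℤ, (∃ i j k : ℤ, x = i * a ∧ y = i * b + j * d ∧ z = i * c + j * e + k * f) ↔
      (∃ i j k : ℤ, x = i * a' ∧ y = i * b' + j * d' ∧ z = i * c' + j * e' + k * f') := by
    intro x y z
    rw [← elt_mem_hermiteSubring (h := h) (n := 0), ← elt_mem_hermiteSubring (h := h') (n := 0), hS]
  have zero_of : ∀ {i : ℤ} {m : ℕ}, 0 < m → 0 = i * m → i = 0 := by
    intro i m hm hi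
    rcases mul_eq_zero.1 hi.symm with h | h
    · exact h
    · omega
  have haa : a = a' := by
    apply Nat.dvd_antisymm
    · obtain ⟨i, j, k, h1, -, -⟩ := (key a' b' c').2 ⟨1, 0, 0, by ring, by ring, by ring⟩
      exact Int.natCast_dvd_natCast.1 ⟨i, by linarith⟩
    · obtain ⟨i, j, k, h1, -, -⟩ := (key a b c).1 ⟨1, 0, 0, by ring, by ring, by ring⟩
      exact Int.natCast_dvd_natCast.1 ⟨i, by linarith⟩
  have hdd : d = d' := by
    apply Nat.dvd_antisymm
    · obtain ⟨i, j, k, h1, h2, -⟩ := (key 0 d' e').2 ⟨0, 1, 0, by ring, by ring, by ring⟩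
      obtain rfl := zero_of ha h1
      exact Int.natCast_dvd_natCast.1 ⟨j, by linarith⟩
    · obtain ⟨i, j, k, h1, h2, -⟩ := (key 0 d e).1 ⟨0, 1, 0, by ring, by ring, by ring⟩
      obtain rfl := zero_of ha' h1
      exact Int.natCast_dvd_natCast.1 ⟨j, by linarith⟩
  have hff : f = f' := by
    apply Nat.dvd_antisymm
    · obtain ⟨i, j, k, h1, h2, h3⟩ := (key 0 0 f').2 ⟨0, 0, 1, by ring, by ring, by ring⟩
      obtain rfl := zero_of ha h1
      obtain rfl := zero_of (i := j) hd (by linarith)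
      exact Int.natCast_dvd_natCast.1 ⟨k, by linarith⟩
    · obtain ⟨i, j, k, h1, h2, h3⟩ := (key 0 0 f).1 ⟨0, 0, 1, by ring, by ring, by ring⟩
      obtain rfl := zero_of ha' h1
      obtain rfl := zero_of (i := j) hd' (by linarith)
      exact Int.natCast_dvd_natCast.1 ⟨k, by linarith⟩
  subst haa hdd hff
  have hee : e' = e := by
    obtain ⟨i, j, k, h1, h2, h3⟩ := (key 0 d e').2 ⟨0, 1, 0, by ring, by ring, by ring⟩
    obtain rfl := zero_of ha h1
    have hj : j - 1 = 0 := zero_of hd (by linarith)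
    obtain rfl : j = 1 := by omega
    obtain rfl := eq_zero_of_mul_eq_sub (u := e') (v := e) (m := f) (i := k)
      (by exact_mod_cast he') (by exact_mod_cast he) (by linarith)
    omega
  subst hee
  obtain ⟨i, j, k, h1, h2, h3⟩ := (key a b' c').2 ⟨1, 0, 0, by ring, by ring, by ring⟩
  have hi : i - 1 = 0 := zero_of ha (by linarith)
  obtain rfl : i = 1 := by omega
  obtain rfl := eq_zero_of_mul_eq_sub (u := b') (v := b) (m := d) (i := j)
      (by exact_mod_cast hb') (by exact_mod_cast hb) (by linarith)
  obtain rfl := eq_zero_of_mul_eq_sub (u := c') (v := c) (m := f) (i := k)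
      (by exact_mod_cast hc') (by exact_mod_cast hc) (by linarith)
  refine ⟨rfl, by omega, by omega, rfl, rfl, rfl⟩

theorem exists_pos_generator (H : AddSubgroup ℤ) {k : ℕ} (hk : k ≠ 0) (hkH : (k : ℤ) ∈ H) :
    ∃ a : ℕ, 0 < a ∧ ∀ x, x ∈ H ↔ (a : ℤ) ∣ x := by
  obtain ⟨g, rfl⟩ := Int.subgroup_cyclic H
  have hmem : ∀ x, x ∈ AddSubgroup.closure {g} ↔ (g.natAbs : ℤ) ∣ x := by
    intro x
    rw [AddSubgroup.mem_closure_singleton, Int.natAbs_dvd]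
    constructor
    · rintro ⟨m, rfl⟩
      exact ⟨m, by simp [mul_comm]⟩
    · rintro ⟨m, rfl⟩
      exact ⟨m, by simp [mul_comm]⟩
  refine ⟨g.natAbs, ?_, hmem⟩
  by_contra h0
  have : g.natAbs = 0 := by omega
  have h2 := (hmem k).1 hkH
  rw [this] at h2
  simp at h2
  exact hk h2

/-- Every subring of finite index has a basis in Hermite normal form: `a`, `d`, `f` generate the
groups of leading coefficients of the elements of order at least `1`, `2`, `3` at `t = 0`. -/
theorem exists_hermiteSubring {k : ℕ} (hk : k ≠ 0) {S : Subring ZtModT4}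
    (hS : S.toAddSubgroup.index = k) :
    ∃ (a b c d e f : ℕ) (h : IsClosedForm a b d e f), 0 < a ∧ 0 < d ∧ 0 < f ∧ b < d ∧ c < f ∧
      e < f ∧ hermiteSubring a b c d e f h = S := by
  have hkS : ∀ r : ZtModT4, (k : ℤ) • r ∈ S := by
    intro r
    have := S.toAddSubgroup.nsmul_index_mem r
    rw [hS] at this
    rw [natCast_zsmul]
    exact this
  -- the groups of leading coefficients of the elements of order at least `1`, `2`, `3`
  let H1 : AddSubgroup ℤ :=
    { carrier := {x | ∃ y z, elt 0 x y z ∈ S}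
      zero_mem' := ⟨0, 0, by rw [elt_zero]; exact S.zero_mem⟩
      add_mem' := by
        rintro x x' ⟨y, z, h⟩ ⟨y', z', h'⟩
        refine ⟨y + y', z + z', ?_⟩
        have := S.add_mem h h'
        rwa [elt_add] at this
      neg_mem' := by
        rintro x ⟨y, z, h⟩
        refine ⟨-y, -z, ?_⟩
        have := S.neg_mem h
        rwa [elt_neg] at this }
  let H2 : AddSubgroup ℤ :=
    { carrier := {y | ∃ z, elt 0 0 y z ∈ S}
      zero_mem' := ⟨0, by rw [elt_zero]; exact S.zero_mem⟩
      add_mem' := by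
        rintro y y' ⟨z, h⟩ ⟨z', h'⟩
        refine ⟨z + z', ?_⟩
        have := S.add_mem h h'
        rwa [elt_add] at this
      neg_mem' := by
        rintro y ⟨z, h⟩
        refine ⟨-z, ?_⟩
        have := S.neg_mem h
        rwa [elt_neg] at this }
  let H3 : AddSubgroup ℤ :=
    { carrier := {z | elt 0 0 0 z ∈ S}
      zero_mem' := by
        change elt 0 0 0 0 ∈ S
        rw [elt_zero]; exact S.zero_mem
      add_mem' := by
        rintro z z' h h'
        have := S.add_mem h h'
        rwa [elt_add] at this
      neg_mem' := by
        rintro z h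
        have := S.neg_mem h
        rwa [elt_neg] at this }
  obtain ⟨a, ha, haH⟩ := exists_pos_generator H1 hk
    ⟨0, 0, by simpa only [zsmul_elt, mul_zero, mul_one] using hkS (elt 0 1 0 0)⟩
  obtain ⟨d, hd, hdH⟩ := exists_pos_generator H2 hk
    ⟨0, by simpa only [zsmul_elt, mul_zero, mul_one] using hkS (elt 0 0 1 0)⟩
  obtain ⟨f, hf, hfH⟩ := exists_pos_generator H3 hk
    (show elt 0 0 0 k ∈ S by simpa only [zsmul_elt, mul_zero, mul_one] using hkS (elt 0 0 0 1))
  have ha' : (0 : ℤ) < a := by exact_mod_cast ha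
  have hd' : (0 : ℤ) < d := by exact_mod_cast hd
  have hf' : (0 : ℤ) < f := by exact_mod_cast hf
  -- basis elements with entries above the diagonal reduced
  have memf : ∀ i : ℤ, elt 0 0 0 (i * f) ∈ S := fun i => (hfH _).2 ⟨i, mul_comm _ _⟩
  obtain ⟨z, hz⟩ := (hdH d).2 dvd_rfl
  obtain ⟨e, he⟩ := Int.eq_ofNat_of_zero_le (Int.emod_nonneg z hf'.ne')
  have he' : (e : ℤ) < f := he ▸ Int.emod_lt_of_pos z hf'
  have hv2 : elt 0 0 d e ∈ S := by
    have h1 := S.sub_mem hz (memf (z / f))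
    rw [elt_sub] at h1
    have h2 := Int.emod_add_mul_ediv z f
    convert h1 using 2 <;> linarith
  have memd : ∀ j : ℤ, elt 0 0 (j * d) (j * e) ∈ S := fun j => by
    have := S.toAddSubgroup.zsmul_mem hv2 j
    rw [zsmul_elt] at this
    simpa using this
  obtain ⟨y, z1, hyz⟩ := (haH a).2 dvd_rfl
  obtain ⟨b, hb⟩ := Int.eq_ofNat_of_zero_le (Int.emod_nonneg y hd'.ne')
  have hb' : (b : ℤ) < d := hb ▸ Int.emod_lt_of_pos y hd'
  obtain ⟨c, hc⟩ := Int.eq_ofNat_of_zero_le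
    (Int.emod_nonneg (z1 - (y / d) * e) hf'.ne')
  have hc' : (c : ℤ) < f := hc ▸ Int.emod_lt_of_pos _ hf'
  have hv1 : elt 0 a b c ∈ S := by
    have h1 := S.sub_mem (S.sub_mem hyz (memd (y / d))) (memf ((z1 - (y / d) * e) / f))
    rw [elt_sub, elt_sub] at h1
    have h2 := Int.emod_add_mul_ediv y d
    have h3 := Int.emod_add_mul_ediv (z1 - (y / d) * e) f
    convert h1 using 2 <;> linarith
  -- products of basis elements lie in `S`, which gives the three divisibility conditions
  have hsq := S.mul_mem hv1 hv1
  rw [elt_mul] at hsq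
  have hdv : d ∣ a ^ 2 := by
    have : (d : ℤ) ∣ 0 * b + a * a + b * 0 := (hdH _).1 ⟨_, by simpa using hsq⟩
    have h2 : (d : ℤ) ∣ ((a ^ 2 : ℕ) : ℤ) := by
      push_cast
      convert this using 1; ring
    exact Int.natCast_dvd_natCast.1 h2
  have hfv : f ∣ a * d := by
    have h1 := S.mul_mem hv1 hv2
    rw [elt_mul] at h1
    have h2 : (f : ℤ) ∣ ((a * d : ℕ) : ℤ) := by
      refine (hfH _).1 ?_
      change elt _ _ _ _ ∈ S
      simpa using h1
    exact Int.natCast_dvd_natCast.1 h2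
  have hcl : IsClosedForm a b d e f := by
    refine ⟨hdv, hfv, ?_⟩
    refine (hfH _).1 ?_
    have h1 := S.sub_mem hsq (memd (a ^ 2 / d : ℕ))
    rw [elt_sub] at h1
    have h1' : (a : ℤ) ^ 2 = d * (a ^ 2 / d : ℕ) := by
      exact_mod_cast (Nat.mul_div_cancel' hdv).symm
    change elt _ _ _ _ ∈ S
    convert h1 using 1
    rw [elt_inj]
    refine ⟨by ring, by ring, by linarith, by push_cast; ring⟩
  refine ⟨a, b, c, d, e, f, hcl, ha, hd, hf, by omega, by omega, by omega, ?_⟩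
  ext r
  obtain ⟨n, x, y, z, rfl⟩ := exists_elt r
  rw [elt_mem_hermiteSubring, elt_mem_iff]
  constructor
  · rintro ⟨i, j, k, rfl, rfl, rfl⟩
    have h1 := S.toAddSubgroup.zsmul_mem hv1 i
    rw [zsmul_elt] at h1
    have h2 := S.add_mem (S.add_mem h1 (memd j)) (memf k)
    rw [elt_add, elt_add] at h2
    simpa using h2
  · intro h
    obtain ⟨i, rfl⟩ := (haH x).1 ⟨y, z, h⟩
    have h1 := S.toAddSubgroup.zsmul_mem hv1 i
    rw [zsmul_elt] at h1
    have h2 := S.sub_mem h h1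
    rw [elt_sub] at h2
    obtain ⟨j, hj⟩ := (hdH (y - i * b)).1 ⟨z - i * c, by
      convert h2 using 2 <;> ring⟩
    have h3 := S.sub_mem h2 (memd j)
    rw [elt_sub] at h3
    obtain ⟨k, hk⟩ := (hfH (z - i * c - j * e)).1 (by
      change elt _ _ _ _ ∈ S
      convert h3 using 2 <;> linarith)
    exact ⟨i, j, k, by ring, by linarith, by linarith⟩

end ZtModT4

/-! ### Counting Hermite normal forms -/

namespace ZtModT4

/-- The image of `(x, y) ↦ m x - c y` in `ℤ/f` is generated by `gcd(m, c)`; comparing its order with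
that of the kernel counts the solutions of a linear congruence in two unknowns. -/
theorem card_filter_dvd_sub {d f m c : ℕ} (hd : 0 < d) (hf : 0 < f) (h : f ∣ m * d) :
    ((Finset.range d ×ˢ Finset.range f).filter
      (fun u => (f : ℤ) ∣ (m : ℤ) * (u.1 : ℕ) - c * (u.2 : ℕ))).card
      = d * ((m.gcd c).gcd f) := by
  have : NeZero d := ⟨hd.ne'⟩
  have : NeZero f := ⟨hf.ne'⟩
  let ψ : ZMod d →+ ZMod f := ZMod.lift d ⟨(AddMonoidHom.mulLeft (m : ZMod f)).comp
    (Int.castAddHom (ZMod f)), by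
      have : ((m * d : ℕ) : ZMod f) = 0 := (ZMod.natCast_eq_zero_iff _ _).2 h
      simpa using this⟩
  have hψ : ∀ x : ℕ, ψ x = m * x := by
    intro x
    have : ψ ((x : ℤ) : ZMod d) = m * ((x : ℤ) : ZMod f) := by
      simp only [ψ, ZMod.lift_coe]
      rfl
    simpa using this
  let φ : ZMod d × ZMod f →+ ZMod f := ψ.coprod (-AddMonoidHom.mulLeft (c : ZMod f))
  have hφ : ∀ x y : ℕ, φ (x, y) = ((m * x - c * y : ℤ) : ZMod f) := by
    intro x y
    simp only [φ, AddMonoidHom.coprod_apply, hψ, AddMonoidHom.neg_apply,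
      AddMonoidHom.coe_mulLeft]
    push_cast
    ring
  have hcard : ((Finset.range d ×ˢ Finset.range f).filter
      (fun u => (f : ℤ) ∣ (m : ℤ) * (u.1 : ℕ) - c * (u.2 : ℕ))).card = Nat.card φ.ker := by
    have hker : Nat.card φ.ker = (Finset.univ.filter (fun v => φ v = 0)).card := by
      rw [Nat.card_eq_fintype_card, ← Fintype.card_subtype]
      exact Fintype.card_congr (Equiv.subtypeEquivRight fun _ => Iff.rfl)
    rw [hker]
    refine Finset.card_bij (fun u _ => ((u.1 : ZMod d), (u.2 : ZMod f))) ?_ ?_ ?_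
    · intro u hu
      rw [Finset.mem_filter] at hu
      rw [Finset.mem_filter, hφ, ZMod.intCast_zmod_eq_zero_iff_dvd]
      exact ⟨Finset.mem_univ _, hu.2⟩
    · rintro ⟨x, y⟩ hx ⟨x', y'⟩ hx' h
      simp only [Finset.mem_filter, Finset.mem_product, Finset.mem_range] at hx hx'
      simp only [Prod.mk.injEq, ZMod.natCast_eq_natCast_iff', Nat.mod_eq_of_lt hx.1.1,
        Nat.mod_eq_of_lt hx.1.2, Nat.mod_eq_of_lt hx'.1.1, Nat.mod_eq_of_lt hx'.1.2] at h
      exact Prod.ext h.1 h.2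
    · rintro ⟨x, y⟩ hxy
      refine ⟨(x.val, y.val), ?_, by simp⟩
      have h2 := (Finset.mem_filter.1 hxy).2
      rw [← ZMod.natCast_zmod_val x, ← ZMod.natCast_zmod_val y, hφ,
        ZMod.intCast_zmod_eq_zero_iff_dvd] at h2
      simp only [Finset.mem_filter, Finset.mem_product, Finset.mem_range]
      exact ⟨⟨ZMod.val_lt x, ZMod.val_lt y⟩, h2⟩
  have hrange : φ.range = AddSubgroup.zmultiples ((m.gcd c : ℕ) : ZMod f) := by
    apply le_antisymm
    · rintro _ ⟨⟨x, y⟩, rfl⟩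
      obtain ⟨x, rfl⟩ := ZMod.natCast_zmod_surjective x
      obtain ⟨y, rfl⟩ := ZMod.natCast_zmod_surjective y
      rw [hφ, AddSubgroup.mem_zmultiples_iff]
      obtain ⟨m', hm'⟩ := Nat.gcd_dvd_left m c
      obtain ⟨c', hc'⟩ := Nat.gcd_dvd_right m c
      refine ⟨m' * x - c' * y, ?_⟩
      have h1 : (m : ℤ) = (m.gcd c : ℕ) * m' := by exact_mod_cast hm'
      have h2 : (c : ℤ) = (m.gcd c : ℕ) * c' := by exact_mod_cast hc'
      rw [h1, h2, zsmul_eq_mul]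
      push_cast
      ring
    · rw [AddSubgroup.zmultiples_le]
      refine ⟨(((m.gcdA c : ℤ) : ZMod d), -((m.gcdB c : ℤ) : ZMod f)), ?_⟩
      have h2 : ψ ((m.gcdA c : ℤ) : ZMod d) = m * ((m.gcdA c : ℤ) : ZMod f) := by
        simp only [ψ, ZMod.lift_coe]
        rfl
      have h3 := congrArg (fun z : ℤ => (z : ZMod f)) (Nat.gcd_eq_gcd_ab m c)
      simp only [φ, AddMonoidHom.coprod_apply, h2, AddMonoidHom.neg_apply,
        AddMonoidHom.coe_mulLeft]
      push_cast at h3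
      rw [h3]
      ring
  have h1 := AddSubgroup.card_mul_index φ.ker
  rw [AddSubgroup.index_ker, hrange, Nat.card_zmultiples, ZMod.addOrderOf_coe _ hf.ne',
    Nat.card_prod, Nat.card_zmod, Nat.card_zmod] at h1
  rw [hcard]
  have h2 := Nat.div_mul_cancel (Nat.gcd_dvd_left f (m.gcd c))
  have h3 : 0 < f / f.gcd (m.gcd c) := Nat.div_pos (Nat.le_of_dvd hf (Nat.gcd_dvd_left _ _))
    (Nat.gcd_pos_of_pos_left _ hf)
  rw [Nat.gcd_comm (m.gcd c) f]
  apply Nat.eq_of_mul_eq_mul_right h3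
  rw [h1, mul_assoc, mul_comm (f.gcd _), h2]

/-- The number of subrings whose Hermite normal form has diagonal `a`, `d`, `f`: the factor `f` is
the number of choices of `c`, the rest is the number of solutions `(b, e)` of the congruence in
`IsClosedForm`. -/
def diagonalCount (a d f : ℕ) : ℕ :=
  if d ∣ a ^ 2 ∧ f ∣ a * d then d * f * ((2 * a).gcd (a ^ 2 / d)).gcd f else 0

open Classical in
/-- The Hermite normal forms of determinant `k` which give subrings; the element
`⟨⟨(u, f), (a, d)⟩, ((b, e), c)⟩` stands for the form with entries `a, b, c, d, e, f`. -/
noncomputable def hermiteForms (k : ℕ) : Finset (Σ _ : (Σ _ : ℕ × ℕ, ℕ × ℕ), (ℕ × ℕ) × ℕ) :=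
  (k.divisorsAntidiagonal.sigma fun u => u.1.divisorsAntidiagonal).sigma fun v =>
    ((Finset.range v.2.2 ×ˢ Finset.range v.1.2).filter
      (fun w => IsClosedForm v.2.1 w.1 v.2.2 w.2 v.1.2)) ×ˢ Finset.range v.1.2

theorem mem_hermiteForms {k u f a d b e c : ℕ} :
    (⟨⟨(u, f), (a, d)⟩, ((b, e), c)⟩ : Σ _ : (Σ _ : ℕ × ℕ, ℕ × ℕ), (ℕ × ℕ) × ℕ) ∈ hermiteForms k ↔
      ((u * f = k ∧ k ≠ 0) ∧ (a * d = u ∧ u ≠ 0)) ∧ ((b < d ∧ e < f) ∧ IsClosedForm a b d e f) ∧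
        c < f := by
  simp [hermiteForms]

open Classical in
theorem card_hermiteForms (k : ℕ) : (hermiteForms k).card =
    ∑ u ∈ k.divisorsAntidiagonal, ∑ v ∈ u.1.divisorsAntidiagonal, diagonalCount v.1 v.2 u.2 := by
  rw [hermiteForms, Finset.card_sigma, Finset.sum_sigma]
  refine Finset.sum_congr rfl fun u hu => Finset.sum_congr rfl fun v hv => ?_
  obtain ⟨u, f⟩ := u
  obtain ⟨a, d⟩ := v
  simp only [Nat.mem_divisorsAntidiagonal] at hu hv
  rw [Finset.card_product, Finset.card_range]
  have hf : 0 < f := Nat.pos_of_ne_zero fun h => hu.2 (by rw [← hu.1, h, mul_zero])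
  have hd : 0 < d := Nat.pos_of_ne_zero fun h => hv.2 (by rw [← hv.1, h, mul_zero])
  simp only [diagonalCount]
  split_ifs with h
  · have h1 : f ∣ 2 * a * d := by
      rw [mul_assoc]; exact h.2.mul_left 2
    have h2 := card_filter_dvd_sub (c := a ^ 2 / d) hd hf h1
    simp only [IsClosedForm, h.1, h.2, true_and]
    rw [h2]
    ring
  · rw [Finset.filter_false_of_mem, Finset.card_empty, zero_mul]
    rintro w - ⟨h1, h2, -⟩
    exact h ⟨h1, h2⟩

theorem exists_equiv_hermiteForms {k : ℕ} (hk : k ≠ 0) :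
    Nonempty (hermiteForms k ≃ subringsOfIndex ZtModT4 k) := by
  let F : hermiteForms k → subringsOfIndex ZtModT4 k := fun x =>
    ⟨hermiteSubring x.1.1.2.1 x.1.2.1.1 x.1.2.2 x.1.1.2.2 x.1.2.1.2 x.1.1.1.2
      (mem_hermiteForms.1 x.2).2.1.2, by
      obtain ⟨⟨⟨⟨u, f⟩, ⟨a, d⟩⟩, ⟨⟨b, e⟩, c⟩⟩, hx⟩ := x
      obtain ⟨⟨⟨rfl, h1⟩, rfl, h2⟩, ⟨⟨h3, h4⟩, h5⟩, h6⟩ := mem_hermiteForms.1 hx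
      exact index_hermiteSubring _ (Nat.pos_of_ne_zero (by rintro rfl; simp at h1))
        (Nat.zero_lt_of_lt h3) (Nat.zero_lt_of_lt h4)⟩
  refine ⟨Equiv.ofBijective F ⟨?_, ?_⟩⟩
  · rintro ⟨⟨⟨⟨u, f⟩, ⟨a, d⟩⟩, ⟨⟨b, e⟩, c⟩⟩, hx⟩ ⟨⟨⟨⟨u', f'⟩, ⟨a', d'⟩⟩, ⟨⟨b', e'⟩, c'⟩⟩, hx'⟩ hF
    have hS := congrArg Subtype.val hF
    dsimp only [F] at hS
    obtain ⟨⟨⟨h0, h1⟩, rfl, h2⟩, ⟨⟨h3, h4⟩, h5⟩, h6⟩ := mem_hermiteForms.1 hx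
    obtain ⟨⟨⟨h0', h1'⟩, rfl, h2'⟩, ⟨⟨h3', h4'⟩, h5'⟩, h6'⟩ := mem_hermiteForms.1 hx'
    obtain ⟨rfl, rfl, rfl, rfl, rfl, rfl⟩ := hermiteSubring_inj
      (Nat.pos_of_ne_zero (by rintro rfl; simp at h2)) (by omega) h3 h6 h4
      (Nat.pos_of_ne_zero (by rintro rfl; simp at h2')) (by omega) h3' h6' h4' hS
    rfl
  · rintro ⟨S, hS⟩
    obtain ⟨a, b, c, d, e, f, h, ha, hd, hf, hb, hc, he, rfl⟩ := exists_hermiteSubring hk hS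
    have hS' : a * d * f = k := by rw [← index_hermiteSubring h ha hd hf]; exact hS
    exact ⟨⟨⟨⟨(a * d, f), (a, d)⟩, ((b, e), c)⟩, mem_hermiteForms.2
      ⟨⟨⟨hS', hk⟩, rfl, (Nat.mul_pos ha hd).ne'⟩, ⟨⟨hb, he⟩, h⟩, hc⟩⟩, rfl⟩

theorem finite_subringsOfIndex {k : ℕ} (hk : k ≠ 0) : (subringsOfIndex ZtModT4 k).Finite := by
  obtain ⟨φ⟩ := exists_equiv_hermiteForms hk
  exact Set.finite_coe_iff.1 (Finite.of_equiv _ φ)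

theorem subringCount_eq {k : ℕ} (hk : k ≠ 0) : subringCount ZtModT4 k =
    ∑ u ∈ k.divisorsAntidiagonal, ∑ v ∈ u.1.divisorsAntidiagonal, diagonalCount v.1 v.2 u.2 := by
  obtain ⟨φ⟩ := exists_equiv_hermiteForms hk
  rw [subringCount, ← Nat.card_coe_set_eq, ← Nat.card_congr φ, ← card_hermiteForms]
  simp

end ZtModT4

/-! ### Multiplicativity of the subring count -/

namespace ZtModT4

theorem sum_divisorsAntidiagonal_mul_of_coprime {M : Type*} [AddCommMonoid M] {m n : ℕ}
    (h : m.Coprime n) (F : ℕ × ℕ → M) :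
    ∑ x ∈ (m * n).divisorsAntidiagonal, F x =
      ∑ y ∈ m.divisorsAntidiagonal, ∑ z ∈ n.divisorsAntidiagonal, F (y.1 * z.1, y.2 * z.2) := by
  have e1 : ∑ x ∈ (m * n).divisorsAntidiagonal, F x = _ :=
    Nat.sum_divisorsAntidiagonal (fun a b => F (a, b))
  have e2 := Nat.sum_divisorsAntidiagonal
    (fun a b => ∑ z ∈ n.divisorsAntidiagonal, F (a * z.1, b * z.2)) (n := m)
  rw [e1, e2, Nat.divisors_mul, Finset.mul_def, Finset.sum_image h.mul_injOn_divisors,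
    Finset.sum_product]
  refine Finset.sum_congr rfl fun a ha => ?_
  rw [Nat.sum_divisorsAntidiagonal (fun x y => F (a * x, m / a * y))]
  refine Finset.sum_congr rfl fun b hb => ?_
  rw [Nat.mul_div_mul_comm (Nat.dvd_of_mem_divisors ha) (Nat.dvd_of_mem_divisors hb)]

theorem mul_dvd_mul_iff_of_coprime {a a' b b' : ℕ} (h1 : a.Coprime b') (h2 : a'.Coprime b) :
    a * a' ∣ b * b' ↔ a ∣ b ∧ a' ∣ b' := by
  constructor
  · intro h
    exact ⟨h1.dvd_of_dvd_mul_right (dvd_of_mul_right_dvd h),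
      h2.dvd_of_dvd_mul_left (dvd_of_mul_left_dvd h)⟩
  · rintro ⟨h, h'⟩
    exact mul_dvd_mul h h'

theorem diagonalCount_mul {a d f a' d' f' : ℕ} (h : (a * d * f).Coprime (a' * d' * f')) :
    diagonalCount (a * a') (d * d') (f * f') = diagonalCount a d f * diagonalCount a' d' f' := by
  have hadf' := h.coprime_mul_right_right
  have haf : a.Coprime f' := h.coprime_mul_left_right.coprime_mul_right.coprime_mul_right
  have hdf : d.Coprime f' := h.coprime_mul_left_right.coprime_mul_right.coprime_mul_left
  have hff : f.Coprime f' := h.coprime_mul_left_right.coprime_mul_left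
  have hfa : f.Coprime a' := hadf'.coprime_mul_right_right.coprime_mul_left
  have hfd : f.Coprime d' := hadf'.coprime_mul_left_right.coprime_mul_left
  have hda : d.Coprime a' := hadf'.coprime_mul_right_right.coprime_mul_right.coprime_mul_left
  have had : a.Coprime d' := hadf'.coprime_mul_left_right.coprime_mul_right.coprime_mul_right
  have e1 : d * d' ∣ (a * a') ^ 2 ↔ d ∣ a ^ 2 ∧ d' ∣ a' ^ 2 := by
    rw [mul_pow]
    exact mul_dvd_mul_iff_of_coprime (hda.pow_right 2) (had.symm.pow_right 2)
  have e2 : f * f' ∣ a * a' * (d * d') ↔ f ∣ a * d ∧ f' ∣ a' * d' := by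
    rw [mul_mul_mul_comm]
    exact mul_dvd_mul_iff_of_coprime (hfa.mul_right hfd) (haf.symm.mul_right hdf.symm)
  simp only [diagonalCount, e1, e2]
  by_cases h1 : d ∣ a ^ 2
  swap
  · simp [h1]
  by_cases h2 : d' ∣ a' ^ 2
  swap
  · simp [h2]
  by_cases h3 : f ∣ a * d
  swap
  · simp [h3]
  by_cases h4 : f' ∣ a' * d'
  swap
  · simp [h4]
  simp only [h1, h2, h3, h4, and_self, if_true]
  have hq : (a * a') ^ 2 / (d * d') = a ^ 2 / d * (a' ^ 2 / d') := by
    rw [mul_pow, Nat.mul_div_mul_comm h1 h2]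
  have hfq : f.Coprime (a' ^ 2 / d') :=
    (hfa.pow_right 2).coprime_dvd_right (Nat.div_dvd_of_dvd h2)
  have hfq' : f'.Coprime (a ^ 2 / d) :=
    (haf.symm.pow_right 2).coprime_dvd_right (Nat.div_dvd_of_dvd h1)
  have g1 : ((2 * (a * a')).gcd (a ^ 2 / d * (a' ^ 2 / d'))).gcd f
      = ((2 * a).gcd (a ^ 2 / d)).gcd f := by
    rw [Nat.gcd_assoc, hfq.symm.gcd_mul_right_cancel, ← Nat.gcd_assoc, Nat.gcd_right_comm,
      ← mul_assoc, hfa.symm.gcd_mul_right_cancel, Nat.gcd_right_comm]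
  have g2 : ((2 * (a * a')).gcd (a ^ 2 / d * (a' ^ 2 / d'))).gcd f'
      = ((2 * a').gcd (a' ^ 2 / d')).gcd f' := by
    rw [Nat.gcd_assoc, hfq'.symm.gcd_mul_left_cancel, ← Nat.gcd_assoc, Nat.gcd_right_comm,
      mul_left_comm, haf.gcd_mul_left_cancel, Nat.gcd_right_comm]
  rw [hq, hff.gcd_mul, g1, g2]
  ring

/-- The subring count of `ℤ[t]/(t⁴)` as an arithmetic function. The value at `0`, which should count
subrings of infinite index, is set to `0`. -/
noncomputable def subringArith : ArithmeticFunction ℕ :=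
  ⟨fun k => if k = 0 then 0 else subringCount ZtModT4 k, rfl⟩

theorem subringArith_apply {k : ℕ} (hk : k ≠ 0) :
    subringArith k = subringCount ZtModT4 k := if_neg hk

theorem subringArith_eq_sum (k : ℕ) : subringArith k =
    ∑ u ∈ k.divisorsAntidiagonal, ∑ v ∈ u.1.divisorsAntidiagonal, diagonalCount v.1 v.2 u.2 := by
  rcases eq_or_ne k 0 with rfl | hk
  · simp
  · rw [subringArith_apply hk, subringCount_eq hk]

theorem isMultiplicative_subringArith : subringArith.IsMultiplicative := by
  constructor
  · simp [subringArith_eq_sum, diagonalCount]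
  · intro m n hmn
    simp only [subringArith_eq_sum]
    rw [sum_divisorsAntidiagonal_mul_of_coprime hmn, Finset.sum_mul_sum]
    refine Finset.sum_congr rfl fun u hu => Finset.sum_congr rfl fun u' hu' => ?_
    obtain ⟨rfl, -⟩ := Nat.mem_divisorsAntidiagonal.1 hu
    obtain ⟨rfl, -⟩ := Nat.mem_divisorsAntidiagonal.1 hu'
    have h1 : u.1.Coprime u'.1 := hmn.coprime_mul_right.coprime_mul_right_right
    rw [sum_divisorsAntidiagonal_mul_of_coprime h1, Finset.sum_mul_sum]
    refine Finset.sum_congr rfl fun v hv => Finset.sum_congr rfl fun v' hv' => ?_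
    obtain ⟨h2, -⟩ := Nat.mem_divisorsAntidiagonal.1 hv
    obtain ⟨h3, -⟩ := Nat.mem_divisorsAntidiagonal.1 hv'
    exact diagonalCount_mul (by rw [h2, h3]; exact hmn)

theorem sum_divisorsAntidiagonal_prime_pow {M : Type*} [AddCommMonoid M] {p : ℕ} (hp : p.Prime)
    (l : ℕ) (F : ℕ × ℕ → M) : ∑ x ∈ (p ^ l).divisorsAntidiagonal, F x =
      ∑ x ∈ Finset.HasAntidiagonal.antidiagonal l, F (p ^ x.1, p ^ x.2) := by
  have e1 : ∑ x ∈ (p ^ l).divisorsAntidiagonal, F x = _ :=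
    Nat.sum_divisorsAntidiagonal (fun a b => F (a, b))
  rw [e1, Nat.sum_divisors_prime_pow hp, Finset.Nat.sum_antidiagonal_eq_sum_range_succ_mk]
  refine Finset.sum_congr rfl fun i hi => ?_
  rw [Nat.pow_div (by simpa [Nat.lt_succ_iff] using hi) hp.pos]

theorem gcd_pow_pow (p i j : ℕ) : (p ^ i).gcd (p ^ j) = p ^ min i j := by
  rcases le_total i j with h | h
  · rw [min_eq_left h, Nat.gcd_eq_left (pow_dvd_pow p h)]
  · rw [min_eq_right h, Nat.gcd_eq_right (pow_dvd_pow p h)]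

/-- The `p`-adic valuation of `2`. -/
def valTwo (p : ℕ) : ℕ := if p = 2 then 1 else 0

theorem diagonalCount_prime_pow {p : ℕ} (hp : p.Prime) (i j k : ℕ) :
    diagonalCount (p ^ i) (p ^ j) (p ^ k) = if j ≤ 2 * i ∧ k ≤ i + j then
      p ^ (j + k + min (min (i + valTwo p) (2 * i - j)) k) else 0 := by
  have hp1 := hp.one_lt
  simp only [diagonalCount, ← pow_mul, ← pow_add, Nat.pow_dvd_pow_iff_le_right hp1]
  rw [mul_comm i 2]
  split_ifs with h
  · have hg : (2 * p ^ i).gcd (p ^ (2 * i - j)) = p ^ min (i + valTwo p) (2 * i - j) := by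
      rw [valTwo]
      split_ifs with h2
      · rw [h2, ← pow_succ', gcd_pow_pow]
      · rw [Nat.Coprime.gcd_mul_left_cancel, gcd_pow_pow, add_zero]
        exact ((Nat.coprime_primes Nat.prime_two hp).2 (Ne.symm h2)).pow_right _
    rw [Nat.pow_div h.1 hp.pos, hg, gcd_pow_pow, ← pow_add]
  · rfl

theorem subringArith_prime_pow {p : ℕ} (hp : p.Prime) (l : ℕ) : subringArith (p ^ l) =
    ∑ u ∈ Finset.HasAntidiagonal.antidiagonal l, ∑ v ∈ Finset.HasAntidiagonal.antidiagonal u.1,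
      if v.2 ≤ 2 * v.1 ∧ u.2 ≤ v.1 + v.2 then
        p ^ (v.2 + u.2 + min (min (v.1 + valTwo p) (2 * v.1 - v.2)) u.2) else 0 := by
  rw [subringArith_eq_sum, sum_divisorsAntidiagonal_prime_pow hp]
  refine Finset.sum_congr rfl fun u _ => ?_
  rw [sum_divisorsAntidiagonal_prime_pow hp]
  exact Finset.sum_congr rfl fun v _ => diagonalCount_prime_pow hp _ _ _

end ZtModT4

/-! ### The local generating function as a formal power series -/

namespace ZtModT4

section GeometricSums

variable {R : Type*} [CommRing R]

theorem sum_range_pow_min (c x : R) {m M : ℕ} (h : m ≤ M) :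
    (1 - c * x) * (1 - c ^ 2 * x) * ∑ k ∈ Finset.range M, c ^ (k + min m k) * x ^ k =
      (1 - c * x) + (c * x - c ^ 2 * x) * (c ^ 2 * x) ^ m
        - (1 - c ^ 2 * x) * c ^ m * (c * x) ^ M := by
  induction M, h using Nat.le_induction with
  | base =>
    have h1 : ∑ k ∈ Finset.range m, c ^ (k + min m k) * x ^ k
        = ∑ k ∈ Finset.range m, (c ^ 2 * x) ^ k := by
      refine Finset.sum_congr rfl fun k hk => ?_
      rw [min_eq_right (Finset.mem_range.1 hk).le]
      ring
    have h2 := mul_neg_geom_sum (c ^ 2 * x) m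
    rw [h1, mul_assoc, h2]
    ring
  | succ M hM ih =>
    rw [Finset.sum_range_succ, mul_add, ih, min_eq_left hM]
    ring

/-- The sum over `j ≤ 2 n` and `k ≤ n + j`, cleared of denominators, for the shape
`min (min m (2 n - j)) k` of the exponent; `b` is the number of `j` for which the inner minimum is
`m`. -/
theorem sum_sum_range_pow_min (c x : R) {b m n : ℕ} (hb : b ≤ n + 1) (hm : m ≤ n + 1)
    (h : b + m = 2 * n + 1) :
    (1 - c * x) * (1 - c ^ 2 * x) * (1 - (c * x) ^ 2) * ((c * x) ^ 2 - c) *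
      ∑ j ∈ Finset.range (2 * n + 1), ∑ k ∈ Finset.range (n + j + 1),
        c ^ (j + k + min (min m (2 * n - j)) k) * x ^ (j + k) =
      (1 - (c * x) ^ 2) * ((c * x) ^ 2 - c) * (1 - (c * x) ^ b * (c ^ 2 * x) ^ m)
      + (1 + c * x) * ((c * x) ^ 2 - c) * (c * x - c ^ 2 * x) * (c ^ 2 * x) ^ m * (1 - (c * x) ^ b)
      - (1 - c ^ 2 * x) * (c * x) ^ (n + 1) * (c ^ m * (1 - ((c * x) ^ b) ^ 2) * ((c * x) ^ 2 - c)
        + (1 - (c * x) ^ 2) * ((c * x) ^ b) ^ 2 * (((c * x) ^ m) ^ 2 - c ^ m)) := by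
  set y := c * x with hy
  set z := c ^ 2 * x with hz
  have h1 : (1 - y) * (1 - z) * ∑ j ∈ Finset.range (2 * n + 1), ∑ k ∈ Finset.range (n + j + 1),
        c ^ (j + k + min (min m (2 * n - j)) k) * x ^ (j + k) =
      ∑ j ∈ Finset.range (2 * n + 1), y ^ j * ((1 - y) + (y - z) * z ^ (min m (2 * n - j))
        - (1 - z) * c ^ (min m (2 * n - j)) * y ^ (n + j + 1)) := by
    rw [Finset.mul_sum]
    refine Finset.sum_congr rfl fun j hj => ?_
    have hj' := Finset.mem_range.1 hj
    rw [← sum_range_pow_min c x (m := min m (2 * n - j)) (M := n + j + 1) (by omega),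
      ← hy, ← hz, mul_left_comm (y ^ j), Finset.mul_sum (a := y ^ j)]
    congr 1
    refine Finset.sum_congr rfl fun k hk => ?_
    rw [hy]
    ring
  have h2 : ∑ j ∈ Finset.range b, y ^ j * ((1 - y) + (y - z) * z ^ (min m (2 * n - j))
        - (1 - z) * c ^ (min m (2 * n - j)) * y ^ (n + j + 1)) =
      ((1 - y) + (y - z) * z ^ m) * ∑ j ∈ Finset.range b, y ^ j
        - (1 - z) * c ^ m * y ^ (n + 1) * ∑ j ∈ Finset.range b, (y ^ 2) ^ j := by
    rw [Finset.mul_sum, Finset.mul_sum, ← Finset.sum_sub_distrib]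
    refine Finset.sum_congr rfl fun j hj => ?_
    have hj' := Finset.mem_range.1 hj
    rw [min_eq_left (by omega)]
    ring
  have h3 : ∑ i ∈ Finset.range m, y ^ (b + i) * ((1 - y)
        + (y - z) * z ^ (min m (2 * n - (b + i)))
        - (1 - z) * c ^ (min m (2 * n - (b + i))) * y ^ (n + (b + i) + 1)) =
      y ^ b * (1 - y) * ∑ i ∈ Finset.range m, y ^ i
        + y ^ b * ((∑ i ∈ Finset.range m, y ^ i * z ^ (m - 1 - i)) * (y - z))
        - (1 - z) * y ^ (n + 1) * (y ^ b) ^ 2 *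
          ∑ i ∈ Finset.range m, (y ^ 2) ^ i * c ^ (m - 1 - i) := by
    rw [Finset.sum_mul, Finset.mul_sum, Finset.mul_sum, Finset.mul_sum, ← Finset.sum_add_distrib,
      ← Finset.sum_sub_distrib]
    refine Finset.sum_congr rfl fun j hj => ?_
    have hj' := Finset.mem_range.1 hj
    rw [show min m (2 * n - (b + j)) = m - 1 - j by omega]
    ring
  have e1 := mul_neg_geom_sum y b
  have e2 := mul_neg_geom_sum (y ^ 2) b
  have e3 := mul_neg_geom_sum y m
  have e4 := geom_sum₂_mul y z m
  have e5 := geom_sum₂_mul (y ^ 2) c m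
  rw [e4] at h3
  have h4 := Finset.sum_range_add (fun j => y ^ j * ((1 - y) + (y - z) * z ^ (min m (2 * n - j))
        - (1 - z) * c ^ (min m (2 * n - j)) * y ^ (n + j + 1))) b m
  rw [h2, h3, h] at h4
  rw [h4] at h1
  linear_combination (1 - y ^ 2) * (y ^ 2 - c) * h1
    + (1 + y) * (y ^ 2 - c) * ((1 - y) + (y - z) * z ^ m) * e1
    - (y ^ 2 - c) * (1 - z) * c ^ m * y ^ (n + 1) * e2
    + (1 - y ^ 2) * (y ^ 2 - c) * y ^ b * e3
    - (1 - y ^ 2) * (1 - z) * y ^ (n + 1) * (y ^ b) ^ 2 * e5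

end GeometricSums

/-- The numerator of the local generating function, in terms of `c = p` and `x = p ^ (-s)`;
`e` is the `p`-adic valuation of `2`. For `e = 1` the expression comes from a computation with
indeterminate `c`, although only `c = 2` occurs; then the term in `x ^ 6` vanishes. -/
def localNumerator {R : Type*} [CommRing R] (e : ℕ) (c x : R) : R :=
  if e = 0 then
    1 + c * x ^ 2 + c ^ 2 * x ^ 3 - c ^ 4 * x ^ 5 - 2 * c ^ 5 * x ^ 6 - 2 * c ^ 6 * x ^ 7
      - c ^ 7 * x ^ 8 + c ^ 9 * x ^ 10 + c ^ 10 * x ^ 11 + c ^ 11 * x ^ 13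
  else
    1 + c * x ^ 2 + c ^ 2 * x ^ 3 - c ^ 4 * x ^ 5 + (c ^ 7 - c ^ 6 - 2 * c ^ 5) * x ^ 6
      - (c ^ 7 + c ^ 6) * x ^ 7 - c ^ 7 * x ^ 8 + c ^ 9 * x ^ 10 + c ^ 10 * x ^ 11
      - (c ^ 12 - c ^ 11) * x ^ 12 + c ^ 12 * x ^ 13

/-- The denominator of the local generating function. -/
def localDenominator {R : Type*} [CommRing R] (c x : R) : R :=
  (1 - c ^ 5 * x ^ 6) * (1 - c ^ 4 * x ^ 4) * (1 - c ^ 3 * x ^ 3) * (1 - c ^ 2 * x ^ 2) * (1 - x)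

/-- The part of the local generating function coming from forms with `v(a) < M`; the summation
variables `n`, `j`, `k` are the valuations of the diagonal entries `a`, `d`, `f`. -/
def truncatedSum {R : Type*} [CommRing R] (e : ℕ) (c x : R) (M : ℕ) : R :=
  ∑ n ∈ Finset.range M, ∑ j ∈ Finset.range (2 * n + 1), ∑ k ∈ Finset.range (n + j + 1),
    c ^ (j + k + min (min (n + e) (2 * n - j)) k) * x ^ (n + j + k)

/-- The closed form behind the telescoping: for fixed `n = v(a)` the sum over the remaining
exponents is a combination of `n`-th powers of the five monomials occurring in the denominator. -/
theorem exists_sum_eq_combination {R : Type*} [CommRing R] {e : ℕ} (he : e ≤ 1) (c x : R) :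
    ∃ k₁ k₂ k₃ k₄ k₅ : R,
      (∀ n : ℕ, (1 - c * x) * (1 - c ^ 2 * x) * (1 - (c * x) ^ 2) * ((c * x) ^ 2 - c) *
        (∑ j ∈ Finset.range (2 * n + 1), ∑ k ∈ Finset.range (n + j + 1),
          c ^ (j + k + min (min (n + e) (2 * n - j)) k) * x ^ (n + j + k)) =
        k₁ * x ^ n + k₂ * (c ^ 2 * x ^ 2) ^ n + k₃ * (c ^ 3 * x ^ 3) ^ n
          + k₄ * (c ^ 4 * x ^ 4) ^ n + k₅ * (c ^ 5 * x ^ 6) ^ n) ∧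
      k₁ * ((1 - c ^ 5 * x ^ 6) * (1 - c ^ 4 * x ^ 4) * (1 - c ^ 3 * x ^ 3) * (1 - c ^ 2 * x ^ 2))
        + k₂ * ((1 - c ^ 5 * x ^ 6) * (1 - c ^ 4 * x ^ 4) * (1 - c ^ 3 * x ^ 3) * (1 - x))
        + k₃ * ((1 - c ^ 5 * x ^ 6) * (1 - c ^ 4 * x ^ 4) * (1 - c ^ 2 * x ^ 2) * (1 - x))
        + k₄ * ((1 - c ^ 5 * x ^ 6) * (1 - c ^ 3 * x ^ 3) * (1 - c ^ 2 * x ^ 2) * (1 - x))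
        + k₅ * ((1 - c ^ 4 * x ^ 4) * (1 - c ^ 3 * x ^ 3) * (1 - c ^ 2 * x ^ 2) * (1 - x)) =
      localNumerator e c x * ((1 - c * x) * (1 - c ^ 2 * x) * (1 - (c * x) ^ 2) *
        ((c * x) ^ 2 - c)) := by
  have hx : ∀ n : ℕ, ∑ j ∈ Finset.range (2 * n + 1), ∑ k ∈ Finset.range (n + j + 1),
      c ^ (j + k + min (min (n + e) (2 * n - j)) k) * x ^ (n + j + k) =
      x ^ n * ∑ j ∈ Finset.range (2 * n + 1), ∑ k ∈ Finset.range (n + j + 1),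
        c ^ (j + k + min (min (n + e) (2 * n - j)) k) * x ^ (j + k) := by
    intro n
    simp only [Finset.mul_sum]
    refine Finset.sum_congr rfl fun j _ => Finset.sum_congr rfl fun k _ => ?_
    rw [add_assoc n, pow_add x n, mul_left_comm]
  -- for `e = 0` the inner minimum `min n (2 n - j)` is `n` for `j < n + 1`, for `e = 1` the minimum
  -- `min (n + 1) (2 n - j)` is `n + 1` for `j < n`
  interval_cases e
  · refine ⟨(1 - (c * x) ^ 2) * ((c * x) ^ 2 - c),
      (1 + c * x) * ((c * x) ^ 2 - c) * (c * x - c ^ 2 * x)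
        - (1 - c ^ 2 * x) * (c * x) * ((c * x) ^ 2 - c),
      -(1 - (c * x) ^ 2) * ((c * x) ^ 2 - c) * (c * x)
        - (1 + c * x) * ((c * x) ^ 2 - c) * (c * x - c ^ 2 * x) * (c * x),
      (1 - c ^ 2 * x) * (c * x) ^ 3 * (1 - c),
      -(1 - c ^ 2 * x) * (c * x) ^ 3 * (1 - (c * x) ^ 2), ?_, ?_⟩
    · intro n
      rw [hx, mul_left_comm, sum_sum_range_pow_min c x (b := n + 1) (m := n + 0) (by omega)
        (by omega) (by omega)]
      ring
    · simp only [localNumerator, if_true]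
      ring
  · refine ⟨(1 - (c * x) ^ 2) * ((c * x) ^ 2 - c),
      (1 + c * x) * ((c * x) ^ 2 - c) * (c * x - c ^ 2 * x) * (c ^ 2 * x)
        - (1 - c ^ 2 * x) * (c * x) * c * ((c * x) ^ 2 - c),
      -(1 - (c * x) ^ 2) * ((c * x) ^ 2 - c) * (c ^ 2 * x)
        - (1 + c * x) * ((c * x) ^ 2 - c) * (c * x - c ^ 2 * x) * (c ^ 2 * x),
      (1 - c ^ 2 * x) * (c * x) * c * (1 - c),
      -(1 - c ^ 2 * x) * (c * x) ^ 3 * (1 - (c * x) ^ 2), ?_, ?_⟩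
    · intro n
      rw [hx, mul_left_comm, sum_sum_range_pow_min c x (b := n) (m := n + 1) (by omega)
        (by omega) (by omega)]
      ring
    · simp only [localNumerator, if_neg one_ne_zero]
      ring

/-- Multiplied by the denominator and an auxiliary factor, the truncated sum telescopes, up to a
multiple of `x ^ M`. -/
theorem exists_truncatedSum_eq {R : Type*} [CommRing R] {e : ℕ} (he : e ≤ 1) (c x : R) (M : ℕ) :
    ∃ r, localDenominator c x * ((1 - c * x) * (1 - c ^ 2 * x) * (1 - (c * x) ^ 2) *
        ((c * x) ^ 2 - c)) * truncatedSum e c x M =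
      localNumerator e c x * ((1 - c * x) * (1 - c ^ 2 * x) * (1 - (c * x) ^ 2) *
        ((c * x) ^ 2 - c)) - x ^ M * r := by
  obtain ⟨k₁, k₂, k₃, k₄, k₅, hk, h0⟩ := exists_sum_eq_combination he c x
  refine ⟨
    k₁ * ((1 - c ^ 5 * x ^ 6) * (1 - c ^ 4 * x ^ 4) * (1 - c ^ 3 * x ^ 3) * (1 - c ^ 2 * x ^ 2))
    + k₂ * ((1 - c ^ 5 * x ^ 6) * (1 - c ^ 4 * x ^ 4) * (1 - c ^ 3 * x ^ 3) * (1 - x))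
      * (c ^ 2 * x) ^ M
    + k₃ * ((1 - c ^ 5 * x ^ 6) * (1 - c ^ 4 * x ^ 4) * (1 - c ^ 2 * x ^ 2) * (1 - x))
      * (c ^ 3 * x ^ 2) ^ M
    + k₄ * ((1 - c ^ 5 * x ^ 6) * (1 - c ^ 3 * x ^ 3) * (1 - c ^ 2 * x ^ 2) * (1 - x))
      * (c ^ 4 * x ^ 3) ^ M
    + k₅ * ((1 - c ^ 4 * x ^ 4) * (1 - c ^ 3 * x ^ 3) * (1 - c ^ 2 * x ^ 2) * (1 - x))
      * (c ^ 5 * x ^ 5) ^ M, ?_⟩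
  generalize localNumerator e c x = N at *
  generalize (1 - c * x) * (1 - c ^ 2 * x) * (1 - (c * x) ^ 2) * ((c * x) ^ 2 - c) = E at *
  induction M with
  | zero =>
    simp only [truncatedSum, Finset.range_zero, Finset.sum_empty, pow_zero]
    linear_combination h0
  | succ M ih =>
    rw [truncatedSum, Finset.sum_range_succ, ← truncatedSum, mul_add, ih]
    have h1 := hk M
    rw [localDenominator, mul_assoc _ E, h1]
    ring

open PowerSeries

theorem coeff_truncatedSum {K : Type*} [CommRing K] (e : ℕ) (c : K) {l M : ℕ} (h : l < M) :
    coeff l (truncatedSum e (C c) (X : PowerSeries K) M) =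
      ∑ u ∈ Finset.HasAntidiagonal.antidiagonal l, ∑ v ∈ Finset.HasAntidiagonal.antidiagonal u.1,
        if v.2 ≤ 2 * v.1 ∧ u.2 ≤ v.1 + v.2 then
          c ^ (v.2 + u.2 + min (min (v.1 + e) (2 * v.1 - v.2)) u.2) else 0 := by
  simp only [truncatedSum, map_sum, ← map_pow, coeff_C_mul, coeff_X_pow, mul_ite, mul_one, mul_zero]
  simp only [Finset.sum_sigma', ← Finset.sum_filter]
  refine Finset.sum_nbij' (fun t => ⟨(t.1 + t.2.1, t.2.2), (t.1, t.2.1)⟩)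
    (fun t => ⟨t.2.1, ⟨t.2.2, t.1.2⟩⟩) ?_ ?_ ?_ ?_ ?_
  · rintro ⟨n, j, k⟩ ht
    simp only [Finset.mem_filter, Finset.mem_sigma, Finset.mem_range,
      Finset.HasAntidiagonal.mem_antidiagonal] at ht ⊢
    exact ⟨by omega, trivial, by omega, by omega⟩
  · rintro ⟨⟨i, k⟩, ⟨n, j⟩⟩ ht
    simp only [Finset.mem_filter, Finset.mem_sigma, Finset.mem_range,
      Finset.HasAntidiagonal.mem_antidiagonal] at ht ⊢
    omega
  · rintro ⟨n, j, k⟩ ht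
    rfl
  · rintro ⟨⟨i, k⟩, ⟨n, j⟩⟩ ht
    simp only [Finset.mem_filter, Finset.mem_sigma, Finset.HasAntidiagonal.mem_antidiagonal] at ht
    obtain ⟨-, rfl, -⟩ := ht
    rfl
  · rintro ⟨n, j, k⟩ ht
    rfl

/-- The generating function of the numbers of subrings of `p`-power index. -/
noncomputable def localSeries (K : Type*) [CommRing K] (p : ℕ) : PowerSeries K :=
  PowerSeries.mk fun l => (subringArith (p ^ l) : K)

theorem localSeries_mul_localDenominator (K : Type*) [CommRing K] [IsDomain K] [CharZero K]
    {p : ℕ} (hp : p.Prime) :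
    localSeries K p * localDenominator (C (p : K)) X = localNumerator (valTwo p) (C (p : K)) X := by
  have he : valTwo p ≤ 1 := by rw [valTwo]; split_ifs <;> simp
  set c : PowerSeries K := C (p : K) with hc
  set E : PowerSeries K := (1 - c * X) * (1 - c ^ 2 * X) * (1 - (c * X) ^ 2) *
        ((c * X) ^ 2 - c) with hE
  -- power series over a domain form a domain, so the auxiliary factor can be cancelled
  have hE0 : E ≠ 0 := by
    intro h
    have := congrArg (constantCoeff (R := K)) h
    simp [hE, hc, hp.ne_zero] at this
  have key : ∀ M, (X : PowerSeries K) ^ M ∣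
      (localSeries K p * localDenominator c X - localNumerator (valTwo p) c X) * E := by
    intro M
    have h1 : (X : PowerSeries K) ^ M ∣ localSeries K p - truncatedSum (valTwo p) c X M := by
      rw [X_pow_dvd_iff]
      intro l hl
      rw [map_sub, coeff_truncatedSum _ _ hl, localSeries, coeff_mk, subringArith_prime_pow hp,
        sub_eq_zero]
      push_cast
      rfl
    obtain ⟨r, hr⟩ := exists_truncatedSum_eq he c (X : PowerSeries K) M
    obtain ⟨s, hs⟩ := h1
    refine ⟨s * localDenominator c X * E - r, ?_⟩
    rw [← hE] at hr
    linear_combination hr + localDenominator c X * E * hs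
  have h0 : (localSeries K p * localDenominator c X - localNumerator (valTwo p) c X) * E = 0 := by
    ext l
    exact X_pow_dvd_iff.1 (key (l + 1)) l (Nat.lt_succ_self l)
  exact sub_eq_zero.1 ((mul_eq_zero.1 h0).resolve_right hE0)

end ZtModT4

/-! ### Evaluation of absolutely convergent power series -/

namespace ZtModT4

open PowerSeries

/-- The power series `P` converges absolutely at `x` to the value `v`, and the sum of the norms of
its terms is at most `M`. The explicit bound is what makes the convergence of a product over all
primes accessible. -/
structure AbsEval (P : PowerSeries ℂ) (x v : ℂ) (M : ℝ) : Prop where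
  summable : Summable fun n => ‖coeff n P * x ^ n‖
  tsum_eq : ∑' n, coeff n P * x ^ n = v
  norm_le : ∑' n, ‖coeff n P * x ^ n‖ ≤ M

namespace AbsEval

variable {P Q : PowerSeries ℂ} {x v w : ℂ} {M N : ℝ}

theorem bound_nonneg (h : AbsEval P x v M) : 0 ≤ M :=
  (tsum_nonneg fun _ => norm_nonneg _).trans h.norm_le

theorem mono (h : AbsEval P x v M) (hMN : M ≤ N) : AbsEval P x v N :=
  ⟨h.summable, h.tsum_eq, h.norm_le.trans hMN⟩

theorem add (hP : AbsEval P x v M) (hQ : AbsEval Q x w N) :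
    AbsEval (P + Q) x (v + w) (M + N) := by
  have h1 : ∀ n, coeff n (P + Q) * x ^ n = coeff n P * x ^ n + coeff n Q * x ^ n := fun n => by
    rw [map_add, add_mul]
  have hs : Summable fun n => ‖coeff n (P + Q) * x ^ n‖ := by
    refine Summable.of_nonneg_of_le (fun _ => norm_nonneg _) (fun n => ?_)
      (hP.summable.add hQ.summable)
    rw [h1]
    exact norm_add_le _ _
  refine ⟨hs, ?_, ?_⟩
  · simp only [h1]
    rw [hP.summable.of_norm.tsum_add hQ.summable.of_norm, hP.tsum_eq, hQ.tsum_eq]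
  · refine (hs.tsum_le_tsum (fun n => ?_) (hP.summable.add hQ.summable)).trans ?_
    · rw [h1]
      exact norm_add_le _ _
    · rw [hP.summable.tsum_add hQ.summable]
      exact add_le_add hP.norm_le hQ.norm_le

theorem mul (hP : AbsEval P x v M) (hQ : AbsEval Q x w N) :
    AbsEval (P * Q) x (v * w) (M * N) := by
  have h1 : ∀ n, coeff n (P * Q) * x ^ n = ∑ u ∈ Finset.HasAntidiagonal.antidiagonal n,
      coeff u.1 P * x ^ u.1 * (coeff u.2 Q * x ^ u.2) := fun n => by
    rw [coeff_mul, Finset.sum_mul]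
    refine Finset.sum_congr rfl fun u hu => ?_
    rw [← Finset.HasAntidiagonal.mem_antidiagonal.1 hu, pow_add]
    ring
  have h2 : ∀ n, ‖coeff n (P * Q) * x ^ n‖ ≤ ∑ u ∈ Finset.HasAntidiagonal.antidiagonal n,
      ‖coeff u.1 P * x ^ u.1‖ * ‖coeff u.2 Q * x ^ u.2‖ := fun n => by
    rw [h1]
    refine (norm_sum_le _ _).trans (le_of_eq ?_)
    simp only [norm_mul]
  have hs : Summable fun n => ‖coeff n (P * Q) * x ^ n‖ := by
    simp only [h1]
    exact summable_norm_sum_mul_antidiagonal_of_summable_norm (f := fun n => coeff n P * x ^ n)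
      (g := fun n => coeff n Q * x ^ n) hP.summable hQ.summable
  have hnn := summable_norm_sum_mul_antidiagonal_of_summable_norm
    (f := fun n => ‖coeff n P * x ^ n‖) (g := fun n => ‖coeff n Q * x ^ n‖) hP.summable.norm hQ.summable.norm
  refine ⟨hs, ?_, ?_⟩
  · simp only [h1]
    rw [← tsum_mul_tsum_eq_tsum_sum_antidiagonal_of_summable_norm hP.summable hQ.summable,
      hP.tsum_eq, hQ.tsum_eq]
  · refine (hs.tsum_le_tsum h2 hnn.of_norm).trans ?_
    rw [← tsum_mul_tsum_eq_tsum_sum_antidiagonal_of_summable_norm hP.summable.norm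
      hQ.summable.norm]
    exact mul_le_mul hP.norm_le hQ.norm_le (tsum_nonneg fun _ => norm_nonneg _) hP.bound_nonneg

theorem monomial (a : ℂ) (k : ℕ) (x : ℂ) :
    AbsEval (C a * X ^ k) x (a * x ^ k) (‖a‖ * ‖x‖ ^ k) := by
  have h1 : ∀ n, coeff n (C a * X ^ k : PowerSeries ℂ) * x ^ n =
      if n = k then a * x ^ k else 0 := by
    intro n
    rw [coeff_C_mul, coeff_X_pow]
    split_ifs with h
    · rw [h, mul_one]
    · simp
  have h2 : ∀ n, ‖coeff n (C a * X ^ k : PowerSeries ℂ) * x ^ n‖ =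
      if n = k then ‖a‖ * ‖x‖ ^ k else 0 := by
    intro n
    rw [h1]
    split_ifs <;> simp
  refine ⟨?_, ?_, ?_⟩
  · simp only [h2]
    exact (hasSum_ite_eq k _).summable
  · simp only [h1, tsum_ite_eq]
  · simp only [h2, tsum_ite_eq, le_refl]

end AbsEval

/-- The power series of `1 / (1 - a X ^ j)`. -/
noncomputable def geomSeries (a : ℂ) (j : ℕ) : PowerSeries ℂ :=
  PowerSeries.mk fun n => if j ∣ n then a ^ (n / j) else 0

theorem geomSeries_mul (a : ℂ) {j : ℕ} (hj : 0 < j) :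
    geomSeries a j * (1 - C a * X ^ j) = 1 := by
  ext n
  rw [mul_sub, mul_one, mul_left_comm, map_sub, coeff_C_mul, coeff_mul_X_pow', coeff_one]
  simp only [geomSeries, coeff_mk]
  rcases eq_or_ne n 0 with rfl | hn
  · simp [hj.ne']
  · rw [if_neg hn]
    by_cases h : j ∣ n
    · obtain ⟨m, rfl⟩ := h
      obtain ⟨m, rfl⟩ := Nat.exists_eq_succ_of_ne_zero (n := m) (by rintro rfl; simp at hn)
      have h1 : j ≤ j * m.succ := Nat.le_mul_of_pos_right _ (Nat.succ_pos _)
      have h2 : j * m.succ - j = j * m := by rw [Nat.mul_succ, Nat.add_sub_cancel]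
      rw [if_pos (dvd_mul_right _ _), if_pos h1, h2, if_pos (dvd_mul_right _ _),
        Nat.mul_div_cancel_left _ hj, Nat.mul_div_cancel_left _ hj, pow_succ]
      ring
    · rw [if_neg h]
      split_ifs with h1 h2
      · exact absurd ((Nat.dvd_sub_iff_left h1 dvd_rfl).1 h2) h
      · simp
      · simp

theorem AbsEval.geom {a x : ℂ} {j : ℕ} (hj : 0 < j) (h : ‖a * x ^ j‖ < 1) :
    AbsEval (geomSeries a j) x (1 - a * x ^ j)⁻¹ (1 - ‖a * x ^ j‖)⁻¹ := by
  have hinj : Function.Injective fun m : ℕ => j * m := fun _ _ h => Nat.mul_left_cancel hj h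
  have h0 : ∀ n, n ∉ Set.range (fun m : ℕ => j * m) → coeff n (geomSeries a j) * x ^ n = 0 := by
    intro n hn
    rw [geomSeries, coeff_mk, if_neg, zero_mul]
    rintro ⟨m, rfl⟩
    exact hn ⟨m, rfl⟩
  have h1 : (fun n => coeff n (geomSeries a j) * x ^ n) ∘ (fun m : ℕ => j * m) =
      fun m => (a * x ^ j) ^ m := by
    funext m
    simp only [Function.comp, geomSeries, coeff_mk, dvd_mul_right, if_true,
      Nat.mul_div_cancel_left _ hj, mul_pow, pow_mul]
  have h2 : (fun n => ‖coeff n (geomSeries a j) * x ^ n‖) ∘ (fun m : ℕ => j * m) =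
      fun m => ‖a * x ^ j‖ ^ m := by
    funext m
    have := congrFun h1 m
    simp only [Function.comp] at this ⊢
    rw [this, norm_pow]
  have hs1 : HasSum (fun n => coeff n (geomSeries a j) * x ^ n) (1 - a * x ^ j)⁻¹ := by
    rw [← hinj.hasSum_iff h0, h1]
    exact hasSum_geometric_of_norm_lt_one h
  have hs2 : HasSum (fun n => ‖coeff n (geomSeries a j) * x ^ n‖) (1 - ‖a * x ^ j‖)⁻¹ := by
    rw [← hinj.hasSum_iff (fun n hn => by rw [h0 n hn, norm_zero]), h2]
    exact hasSum_geometric_of_lt_one (norm_nonneg _) h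
  exact ⟨hs2.summable, hs1.tsum_eq, hs2.tsum_eq.le⟩

/-! ### The local factors -/

/-- The local series with the factor `1 / (1 - p² X²)`, which carries the pole, removed. -/
noncomputable def reducedSeries (p : ℕ) : PowerSeries ℂ :=
  localNumerator (valTwo p) (C (p : ℂ)) X * geomSeries (p ^ 5) 6 * geomSeries (p ^ 4) 4 *
    geomSeries (p ^ 3) 3 * geomSeries 1 1

theorem localSeries_eq {p : ℕ} (hp : p.Prime) :
    localSeries ℂ p = geomSeries (p ^ 2) 2 * reducedSeries p := by
  have h := localSeries_mul_localDenominator ℂ hp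
  have h6 := geomSeries_mul (p ^ 5) (j := 6) (by norm_num)
  have h4 := geomSeries_mul (p ^ 4) (j := 4) (by norm_num)
  have h3 := geomSeries_mul (p ^ 3) (j := 3) (by norm_num)
  have h2 := geomSeries_mul (p ^ 2) (j := 2) (by norm_num)
  have h1 := geomSeries_mul 1 (j := 1) (by norm_num)
  rw [map_pow] at h2 h3 h4 h6
  rw [map_one, one_mul, pow_one] at h1
  rw [reducedSeries, ← h, localDenominator]
  generalize localSeries ℂ p = A
  calc A = A * 1 * 1 * 1 * 1 * 1 := by simp only [mul_one]
    _ = A * (geomSeries (p ^ 5) 6 * (1 - C (p : ℂ) ^ 5 * X ^ 6)) *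
        (geomSeries (p ^ 4) 4 * (1 - C (p : ℂ) ^ 4 * X ^ 4)) *
        (geomSeries (p ^ 3) 3 * (1 - C (p : ℂ) ^ 3 * X ^ 3)) *
        (geomSeries (p ^ 2) 2 * (1 - C (p : ℂ) ^ 2 * X ^ 2)) *
        (geomSeries 1 1 * (1 - X)) := by rw [h6, h4, h3, h2, h1]
    _ = _ := by ring

theorem pow_mul_pow_le {q r : ℝ} (hq : 0 ≤ q) (hr : 0 ≤ r) (hr1 : r ≤ 1) (hqr : q * r ≤ 1)
    {i j : ℕ} (hi : 1 ≤ i) (hij : i + 1 ≤ j) : q ^ i * r ^ j ≤ q * r ^ 2 := by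
  obtain ⟨i, rfl⟩ := Nat.exists_eq_add_of_le hi
  obtain ⟨j, rfl⟩ := Nat.exists_eq_add_of_le hij
  have h1 : q ^ (1 + i) * r ^ (1 + i + 1 + j) = q * r ^ 2 * ((q * r) ^ i * r ^ j) := by ring
  rw [h1]
  refine mul_le_of_le_one_right (by positivity) ?_
  exact mul_le_one₀ (pow_le_one₀ (by positivity) hqr) (by positivity) (pow_le_one₀ hr hr1)

/-- Every monomial of the numerator other than `1` is `pⁱ xʲ` with `1 ≤ i < j`, hence at most
`p ‖x‖²`; the absolute values of their coefficients add up to `11` (for `p = 2`, with `2⁷ + 2⁶`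
read as `3 * 2⁶`). -/
theorem absEval_localNumerator {p : ℕ} {x : ℂ} (hx1 : ‖x‖ ≤ 1) (hpx : p * ‖x‖ ≤ 1) :
    AbsEval (localNumerator (valTwo p) (C (p : ℂ)) X) x (localNumerator (valTwo p) (p : ℂ) x)
      (1 + 11 * (p * ‖x‖ ^ 2)) := by
  have hb : ∀ i j : ℕ, 1 ≤ i → i + 1 ≤ j → (p : ℝ) ^ i * ‖x‖ ^ j ≤ p * ‖x‖ ^ 2 := fun i j hi hij =>
    pow_mul_pow_le (Nat.cast_nonneg p) (norm_nonneg x) hx1 hpx hi hij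
  by_cases hp : p = 2
  · subst hp
    have h := ((((((((((AbsEval.monomial 1 0 x).add (.monomial 2 2 x)).add
      (.monomial (2 ^ 2) 3 x)).add (.monomial (-2 ^ 4) 5 x)).add
      (.monomial (-(3 * 2 ^ 6)) 7 x)).add (.monomial (-2 ^ 7) 8 x)).add
      (.monomial (2 ^ 9) 10 x)).add (.monomial (2 ^ 10) 11 x)).add
      (.monomial (-2 ^ 11) 12 x)).add (.monomial (2 ^ 12) 13 x))
    convert h.mono (N := 1 + 11 * (((2 : ℕ) : ℝ) * ‖x‖ ^ 2)) ?_ using 1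
    · simp only [localNumerator, valTwo, if_true, if_neg one_ne_zero, map_neg, map_mul, map_pow,
        map_one, Nat.cast_ofNat, map_ofNat]
      ring
    · simp only [localNumerator, valTwo, if_true, if_neg one_ne_zero, Nat.cast_ofNat]
      ring
    · have b1 := hb 1 2 (by norm_num) (by norm_num)
      have b2 := hb 2 3 (by norm_num) (by norm_num)
      have b3 := hb 4 5 (by norm_num) (by norm_num)
      have b4 := hb 6 7 (by norm_num) (by norm_num)
      have b5 := hb 7 8 (by norm_num) (by norm_num)
      have b6 := hb 9 10 (by norm_num) (by norm_num)
      have b7 := hb 10 11 (by norm_num) (by norm_num)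
      have b8 := hb 11 12 (by norm_num) (by norm_num)
      have b9 := hb 12 13 (by norm_num) (by norm_num)
      simp only [norm_neg, norm_mul, norm_pow, norm_one, Complex.norm_ofNat, Nat.cast_ofNat]
        at b1 b2 b3 b4 b5 b6 b7 b8 b9 ⊢
      linarith
  · have h := (((((((((AbsEval.monomial 1 0 x).add (.monomial p 2 x)).add
      (.monomial (p ^ 2) 3 x)).add (.monomial (-p ^ 4) 5 x)).add
      (.monomial (-(2 * p ^ 5)) 6 x)).add
      (.monomial (-(2 * p ^ 6)) 7 x)).add (.monomial (-p ^ 7) 8 x)).add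
      (.monomial (p ^ 9) 10 x)).add (.monomial (p ^ 10) 11 x)).add
      (.monomial (p ^ 11) 13 x)
    convert h.mono (N := 1 + 11 * ((p : ℝ) * ‖x‖ ^ 2)) ?_ using 1
    · simp only [localNumerator, valTwo, if_neg hp, if_true, map_neg, map_mul, map_pow,
        map_one, map_ofNat]
      ring
    · simp only [localNumerator, valTwo, if_neg hp, if_true]
      ring
    · have b1 := hb 1 2 (by norm_num) (by norm_num)
      have b2 := hb 2 3 (by norm_num) (by norm_num)
      have b3 := hb 4 5 (by norm_num) (by norm_num)
      have b4 := hb 5 6 (by norm_num) (by norm_num)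
      have b5 := hb 6 7 (by norm_num) (by norm_num)
      have b6 := hb 7 8 (by norm_num) (by norm_num)
      have b7 := hb 9 10 (by norm_num) (by norm_num)
      have b8 := hb 10 11 (by norm_num) (by norm_num)
      have b9 := hb 11 13 (by norm_num) (by norm_num)
      simp only [norm_neg, norm_mul, norm_pow, norm_one, Complex.norm_ofNat, Complex.norm_natCast]
        at b1 b2 b3 b4 b5 b6 b7 b8 b9 ⊢
      linarith

theorem norm_pow_mul_pow_lt_one {p : ℕ} {x : ℂ} (hx1 : ‖x‖ < 1) (hpx : p * ‖x‖ < 1) {i j : ℕ}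
    (hij : i ≤ j) (hj : 0 < j) : ‖(p : ℂ) ^ i * x ^ j‖ < 1 := by
  obtain ⟨j, rfl⟩ := Nat.exists_eq_add_of_le hij
  have h1 : ‖(p : ℂ) ^ i * x ^ (i + j)‖ = (p * ‖x‖) ^ i * ‖x‖ ^ j := by
    simp only [norm_mul, norm_pow, Complex.norm_natCast]
    ring
  rw [h1]
  rcases Nat.eq_zero_or_pos i with rfl | hi
  · rw [pow_zero, one_mul]
    exact pow_lt_one₀ (norm_nonneg x) hx1 (by omega)
  · exact mul_lt_one_of_nonneg_of_lt_one_left (by positivity)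
      (pow_lt_one₀ (by positivity) hpx hi.ne') (pow_le_one₀ (norm_nonneg x) hx1.le)

/-- The value of the local factor with `1 / (1 - p² x²)` removed. -/
noncomputable def reducedFactor (p : ℕ) (x : ℂ) : ℂ :=
  localNumerator (valTwo p) (p : ℂ) x * (1 - (p : ℂ) ^ 5 * x ^ 6)⁻¹ * (1 - (p : ℂ) ^ 4 * x ^ 4)⁻¹ *
    (1 - (p : ℂ) ^ 3 * x ^ 3)⁻¹ * (1 - x)⁻¹

theorem absEval_reducedSeries {p : ℕ} {x : ℂ} (hx1 : ‖x‖ < 1) (hpx : p * ‖x‖ < 1) :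
    AbsEval (reducedSeries p) x (reducedFactor p x)
      ((1 + 11 * (p * ‖x‖ ^ 2)) * (1 - p ^ 5 * ‖x‖ ^ 6)⁻¹ * (1 - p ^ 4 * ‖x‖ ^ 4)⁻¹ *
        (1 - p ^ 3 * ‖x‖ ^ 3)⁻¹ * (1 - ‖x‖)⁻¹) := by
  have h := ((((absEval_localNumerator hx1.le hpx.le).mul
    (.geom (a := p ^ 5) (j := 6) (by norm_num)
      (norm_pow_mul_pow_lt_one hx1 hpx (by norm_num) (by norm_num)))).mul
    (.geom (a := p ^ 4) (j := 4) (by norm_num)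
      (norm_pow_mul_pow_lt_one hx1 hpx (by norm_num) (by norm_num)))).mul
    (.geom (a := p ^ 3) (j := 3) (by norm_num)
      (norm_pow_mul_pow_lt_one hx1 hpx (by norm_num) (by norm_num)))).mul
    (.geom (a := 1) (j := 1) (by norm_num) (by simpa using hx1))
  rw [reducedSeries, reducedFactor]
  simpa only [norm_mul, norm_pow, Complex.norm_natCast, norm_one, one_mul, pow_one] using h

theorem absEval_localSeries {p : ℕ} (hp : p.Prime) {x : ℂ} (hx1 : ‖x‖ < 1) (hpx : p * ‖x‖ < 1) :
    ∃ M, AbsEval (localSeries ℂ p) x ((1 - (p : ℂ) ^ 2 * x ^ 2)⁻¹ * reducedFactor p x) M := by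
  rw [localSeries_eq hp]
  exact ⟨_, (AbsEval.geom (a := p ^ 2) (j := 2) (by norm_num)
    (norm_pow_mul_pow_lt_one hx1 hpx (by norm_num) (by norm_num))).mul
    (absEval_reducedSeries hx1 hpx)⟩

end ZtModT4

/-! ### Dirichlet series of multiplicative functions -/

namespace ZtModT4

/-- A nonnegative multiplicative function is summable as soon as its local sums are bounded by
`exp (b p)` with `b` summable: every finite partial sum is bounded by a finite Euler product. -/
theorem summable_of_multiplicative {g : ℕ → ℝ} (h0 : g 0 = 0) (h1 : g 1 = 1)
    (hmul : ∀ {m n : ℕ}, m.Coprime n → g (m * n) = g m * g n) (hnn : ∀ n, 0 ≤ g n)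
    (hs : ∀ p : ℕ, p.Prime → Summable fun l => g (p ^ l)) {b : ℕ → ℝ} (hb : Summable b)
    (hb0 : ∀ p, 0 ≤ b p) (hle : ∀ p : ℕ, p.Prime → ∑' l, g (p ^ l) ≤ Real.exp (b p)) :
    Summable g := by
  refine summable_of_sum_le hnn (c := Real.exp (∑' p, b p)) fun u => ?_
  obtain ⟨N, hN⟩ : ∃ N : ℕ, ∀ m ∈ u, m < N :=
    ⟨u.sup id + 1, fun m hm => Nat.lt_succ_of_le (Finset.le_sup (f := id) hm)⟩
  have h := (EulerProduct.summable_and_hasSum_smoothNumbers_prod_primesBelow_tsum h1 hmul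
    (fun {p} hp => (hs p hp).norm) N).2
  have h2 : ∑ m ∈ u, g m = ∑ m ∈ u, (N.smoothNumbers.indicator g) m := by
    refine Finset.sum_congr rfl fun m hm => ?_
    rcases Nat.eq_zero_or_pos m with rfl | hm0
    · rw [h0]
      by_cases h : 0 ∈ N.smoothNumbers
      · rw [Set.indicator_of_mem h, h0]
      · rw [Set.indicator_of_notMem h]
    · rw [Set.indicator_of_mem (Nat.mem_smoothNumbers_of_lt hm0 (hN m hm))]
  have h' := (hasSum_subtype_iff_indicator (f := g) (s := N.smoothNumbers)).1 h
  rw [h2]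
  refine (sum_le_hasSum u (fun m _ => Set.indicator_nonneg (fun m _ => hnn m) m) h').trans ?_
  refine (Finset.prod_le_prod (fun p _ => tsum_nonneg fun l => hnn _)
    (fun p hp => hle p (Nat.prime_of_mem_primesBelow hp))).trans ?_
  rw [← Real.exp_sum]
  exact Real.exp_le_exp.2 (hb.sum_le_tsum _ fun p _ => hb0 p)

theorem LSeries_term_one {f : ArithmeticFunction ℂ} (hf : f.IsMultiplicative) (s : ℂ) :
    LSeries.term f s 1 = 1 := by
  simp [hf.map_one]

theorem LSeries_term_mul {f : ArithmeticFunction ℂ} (hf : f.IsMultiplicative) (s : ℂ) {m n : ℕ}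
    (h : m.Coprime n) : LSeries.term f s (m * n) = LSeries.term f s m * LSeries.term f s n := by
  simp only [LSeries.term_def]
  rcases eq_or_ne m 0 with rfl | hm
  · simp
  rcases eq_or_ne n 0 with rfl | hn
  · simp
  rw [if_neg hm, if_neg hn, if_neg (mul_ne_zero hm hn), hf.map_mul_of_coprime h, Nat.cast_mul,
    Complex.natCast_mul_natCast_cpow, mul_div_mul_comm]

theorem natCast_pow_cpow (p l : ℕ) (s : ℂ) : ((p ^ l : ℕ) : ℂ) ^ s = ((p : ℂ) ^ s) ^ l := by
  induction l with
  | zero => simp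
  | succ l ih =>
    rw [pow_succ, Nat.cast_mul, Complex.natCast_mul_natCast_cpow, ih, pow_succ]

theorem LSeries_term_prime_pow {p : ℕ} (hp : p.Prime) (f : ℕ → ℂ) (s : ℂ) (l : ℕ) :
    LSeries.term f s (p ^ l) = f (p ^ l) * ((p : ℂ) ^ (-s)) ^ l := by
  rw [LSeries.term_def, if_neg (pow_ne_zero l hp.ne_zero), natCast_pow_cpow, Complex.cpow_neg,
    inv_pow, div_eq_mul_inv]

/-- The arithmetic function which is multiplicative with prescribed values on prime powers. -/
noncomputable def multiplicativeExtension (c : ℕ → ℕ → ℂ) : ArithmeticFunction ℂ :=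
  ⟨fun n => if n = 0 then 0 else n.factorization.prod c, if_pos rfl⟩

theorem isMultiplicative_multiplicativeExtension (c : ℕ → ℕ → ℂ) :
    (multiplicativeExtension c).IsMultiplicative := by
  rw [ArithmeticFunction.IsMultiplicative.iff_ne_zero]
  constructor
  · simp [multiplicativeExtension]
  · intro m n hm hn h
    simp only [multiplicativeExtension, ArithmeticFunction.coe_mk, if_neg hm, if_neg hn,
      if_neg (mul_ne_zero hm hn)]
    rw [Nat.factorization_mul_of_coprime h,
      Finsupp.prod_add_index_of_disjoint (by simpa using h.disjoint_primeFactors)]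

theorem multiplicativeExtension_prime_pow (c : ℕ → ℕ → ℂ) (hc : ∀ p, c p 0 = 1) {p : ℕ}
    (hp : p.Prime) (l : ℕ) : multiplicativeExtension c (p ^ l) = c p l := by
  simp only [multiplicativeExtension, ArithmeticFunction.coe_mk,
    if_neg (pow_ne_zero l hp.ne_zero)]
  rw [hp.factorization_pow, Finsupp.prod_single_index (hc p)]

theorem mul_apply_prime_pow (f g : ArithmeticFunction ℂ) {p : ℕ} (hp : p.Prime) (l : ℕ) :
    (f * g) (p ^ l) = PowerSeries.coeff l
      (PowerSeries.mk (fun i => f (p ^ i)) * PowerSeries.mk (fun i => g (p ^ i))) := by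
  rw [ArithmeticFunction.mul_apply, sum_divisorsAntidiagonal_prime_pow hp, PowerSeries.coeff_mul]
  simp only [PowerSeries.coeff_mk]

/-! ### The factorization `a = squareArith * reducedArith` -/

open Classical in
/-- The coefficients of `ζ(2s - 2) = ∑ m² / (m²) ^ s`. -/
noncomputable def squareArith : ArithmeticFunction ℂ :=
  ⟨fun k => if IsSquare k then k else 0, by simp⟩

theorem squareArith_sq (m : ℕ) : squareArith (m ^ 2) = (m : ℂ) ^ 2 := by
  simp [squareArith, IsSquare.sq m]

theorem isSquare_mul_iff_of_coprime {m n : ℕ} (h : m.Coprime n) :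
    IsSquare (m * n) ↔ IsSquare m ∧ IsSquare n := by
  constructor
  · rintro ⟨r, hr⟩
    rw [← sq] at hr
    constructor
    · obtain ⟨d, hd⟩ := exists_eq_pow_of_mul_eq_pow
        (show IsUnit (gcd m n) from Nat.isUnit_iff.2 h) hr
      exact ⟨d, by rw [hd, sq]⟩
    · obtain ⟨d, hd⟩ := exists_eq_pow_of_mul_eq_pow
        (show IsUnit (gcd n m) from Nat.isUnit_iff.2 h.symm) (by rw [mul_comm, hr])
      exact ⟨d, by rw [hd, sq]⟩
  · rintro ⟨h, h'⟩
    exact h.mul h'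

theorem isMultiplicative_squareArith : squareArith.IsMultiplicative := by
  constructor
  · simp [squareArith]
  · intro m n h
    simp only [squareArith, ArithmeticFunction.coe_mk, isSquare_mul_iff_of_coprime h]
    by_cases h1 : IsSquare m <;> by_cases h2 : IsSquare n <;> simp [h1, h2]

theorem squareArith_prime_pow {p : ℕ} (hp : p.Prime) (l : ℕ) :
    squareArith (p ^ l) = PowerSeries.coeff l (geomSeries (p ^ 2) 2) := by
  have h : IsSquare (p ^ l) ↔ 2 ∣ l := by
    constructor
    · rintro ⟨r, hr⟩
      obtain ⟨k, -, rfl⟩ := (Nat.dvd_prime_pow hp).1 (Dvd.intro _ hr.symm)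
      rw [← pow_add] at hr
      have := Nat.pow_right_injective hp.two_le hr
      omega
    · rintro ⟨k, rfl⟩
      exact ⟨p ^ k, by rw [two_mul, pow_add]⟩
  simp only [squareArith, ArithmeticFunction.coe_mk, geomSeries, PowerSeries.coeff_mk, h]
  split_ifs with h2
  · rw [← pow_mul, Nat.mul_div_cancel' h2, Nat.cast_pow]
  · rfl

/-- The multiplicative function whose local series are the `reducedSeries`. Its Dirichlet series
converges absolutely for `Re s > 4/3`. -/
noncomputable def reducedArith : ArithmeticFunction ℂ :=
  multiplicativeExtension fun p l => PowerSeries.coeff l (reducedSeries p)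

theorem reducedArith_prime_pow {p : ℕ} (hp : p.Prime) (l : ℕ) :
    reducedArith (p ^ l) = PowerSeries.coeff l (reducedSeries p) := by
  refine multiplicativeExtension_prime_pow _ (fun p => ?_) hp l
  have h1 : PowerSeries.constantCoeff
      (localNumerator (valTwo p) (PowerSeries.C (p : ℂ)) PowerSeries.X) = 1 := by
    rw [localNumerator]
    split_ifs <;> simp
  have h2 : ∀ (a : ℂ) (j : ℕ), PowerSeries.constantCoeff (geomSeries a j) = 1 := by
    intro a j
    rw [← PowerSeries.coeff_zero_eq_constantCoeff_apply, geomSeries, PowerSeries.coeff_mk]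
    simp
  simp only [reducedSeries, PowerSeries.coeff_zero_eq_constantCoeff, map_mul, h1, h2, mul_one]

theorem isMultiplicative_reducedArith : reducedArith.IsMultiplicative :=
  isMultiplicative_multiplicativeExtension _

theorem subringArith_eq_mul :
    (subringArith : ArithmeticFunction ℂ) = squareArith * reducedArith := by
  rw [isMultiplicative_subringArith.natCast.eq_iff_eq_on_prime_powers _ _
    (isMultiplicative_squareArith.mul isMultiplicative_reducedArith)]
  intro p l hp
  have h1 : PowerSeries.mk (fun i => squareArith (p ^ i)) = geomSeries (p ^ 2) 2 := by
    ext i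
    rw [PowerSeries.coeff_mk, squareArith_prime_pow hp]
  have h2 : PowerSeries.mk (fun i => reducedArith (p ^ i)) = reducedSeries p := by
    ext i
    rw [PowerSeries.coeff_mk, reducedArith_prime_pow hp]
  rw [mul_apply_prime_pow _ _ hp, h1, h2, ← localSeries_eq hp, localSeries, PowerSeries.coeff_mk,
    ArithmeticFunction.natCoe_apply]

theorem hasSum_squareArith {s : ℂ} (hs : 3 / 2 < s.re) :
    LSeriesHasSum squareArith s (riemannZeta (2 * s - 2)) := by
  have hre : 1 < (2 * s - 2).re := by
    simp only [Complex.sub_re, Complex.mul_re, Complex.re_ofNat, Complex.im_ofNat]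
    linarith
  have hinj : Function.Injective fun m : ℕ => m ^ 2 := Nat.pow_left_injective (by norm_num)
  rw [LSeriesHasSum, ← hinj.hasSum_iff]
  · have h1 : LSeries.term squareArith s ∘ (fun m : ℕ => m ^ 2) =
        fun m : ℕ => 1 / (m : ℂ) ^ (2 * s - 2) := by
      funext m
      rcases eq_or_ne m 0 with rfl | hm
      · simp only [Function.comp, LSeries.term_def]
        rw [if_pos (by norm_num), Nat.cast_zero, Complex.zero_cpow, div_zero]
        intro h
        rw [h] at hre
        norm_num at hre
      · have hm' : (m : ℂ) ≠ 0 := Nat.cast_ne_zero.2 hm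
        simp only [Function.comp, LSeries.term_def]
        rw [if_neg (pow_ne_zero 2 hm), squareArith_sq, natCast_pow_cpow, Complex.cpow_sub _ _ hm',
          Complex.cpow_ofNat, two_mul, Complex.cpow_add _ _ hm', ← sq, one_div_div]
    rw [h1, zeta_eq_tsum_one_div_nat_cpow hre]
    exact (Complex.summable_one_div_nat_cpow.2 hre).hasSum
  · intro k hk
    have : ¬ IsSquare k := by
      rintro ⟨r, rfl⟩
      exact hk ⟨r, sq r⟩
    simp [LSeries.term_def, squareArith, this]

end ZtModT4

/-! ### Convergence and Euler products -/

namespace ZtModT4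

theorem norm_prime_cpow_neg {p : ℕ} (hp : p.Prime) (s : ℂ) :
    ‖(p : ℂ) ^ (-s)‖ = (p : ℝ) ^ (-s.re) := by
  rw [Complex.norm_natCast_cpow_of_pos hp.pos, Complex.neg_re]

theorem pow_mul_rpow_neg_pow {p : ℕ} (hp : p.Prime) (a k : ℕ) (σ : ℝ) :
    (p : ℝ) ^ a * ((p : ℝ) ^ (-σ)) ^ k = (p : ℝ) ^ (a - k * σ) := by
  have hp0 : (0 : ℝ) < p := Nat.cast_pos.2 hp.pos
  rw [← Real.rpow_natCast, ← Real.rpow_natCast, ← Real.rpow_mul hp0.le, ← Real.rpow_add hp0]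
  congr 1
  ring

theorem norm_prime_cpow_neg_lt_one {p : ℕ} (hp : p.Prime) {s : ℂ} (hs : 1 < s.re) :
    ‖(p : ℂ) ^ (-s)‖ < 1 ∧ p * ‖(p : ℂ) ^ (-s)‖ < 1 := by
  have hp1 : (1 : ℝ) < p := Nat.one_lt_cast.2 hp.one_lt
  rw [norm_prime_cpow_neg hp]
  refine ⟨Real.rpow_lt_one_of_one_lt_of_neg hp1 (by linarith), ?_⟩
  have := pow_mul_rpow_neg_pow hp 1 1 s.re
  rw [pow_one, pow_one] at this
  rw [this]
  exact Real.rpow_lt_one_of_one_lt_of_neg hp1 (by push_cast; linarith)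

theorem inv_one_sub_le_exp {u : ℝ} (h0 : 0 ≤ u) (h : u ≤ 1 / 2) :
    (1 - u)⁻¹ ≤ Real.exp (2 * u) := by
  refine le_trans ?_ (Real.add_one_le_exp _)
  rw [inv_le_iff_one_le_mul₀ (by linarith)]
  nlinarith

theorem rpow_le_half {p : ℕ} (hp : p.Prime) {τ : ℝ} (h : τ ≤ -1) : (p : ℝ) ^ τ ≤ 1 / 2 := by
  have hp2 : (2 : ℝ) ≤ p := Nat.ofNat_le_cast.2 hp.two_le
  calc (p : ℝ) ^ τ ≤ (p : ℝ) ^ (-1 : ℝ) := Real.rpow_le_rpow_of_exponent_le (by linarith) h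
    _ = (p : ℝ)⁻¹ := Real.rpow_neg_one _
    _ ≤ 2⁻¹ := inv_anti₀ (by norm_num) hp2
    _ = 1 / 2 := by norm_num

theorem LSeriesSummable_reducedArith {s : ℂ} (hs : 4 / 3 < s.re) :
    LSeriesSummable reducedArith s := by
  have hs1 : 1 < s.re := by linarith
  set σ := s.re with hσ
  let b : ℕ → ℝ := fun p => 11 * (p : ℝ) ^ (1 - 2 * σ) + 2 * (p : ℝ) ^ (5 - 6 * σ)
    + 2 * (p : ℝ) ^ (4 - 4 * σ) + 2 * (p : ℝ) ^ (3 - 3 * σ) + 2 * (p : ℝ) ^ (-σ)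
  have hb : Summable b := by
    refine ((((Summable.mul_left _ ?_).add (Summable.mul_left _ ?_)).add
      (Summable.mul_left _ ?_)).add (Summable.mul_left _ ?_)).add (Summable.mul_left _ ?_) <;>
    · rw [Real.summable_nat_rpow]
      linarith
  have hf : ∀ p l : ℕ, p.Prime → LSeries.term reducedArith s (p ^ l) =
      PowerSeries.coeff l (reducedSeries p) * ((p : ℂ) ^ (-s)) ^ l := fun p l hp => by
    rw [LSeries_term_prime_pow hp, reducedArith_prime_pow hp]
  have heval : ∀ p : ℕ, p.Prime → _ := fun p hp =>
    absEval_reducedSeries (norm_prime_cpow_neg_lt_one hp hs1).1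
      (norm_prime_cpow_neg_lt_one hp hs1).2
  refine Summable.of_norm (summable_of_multiplicative (b := b) ?_ ?_ ?_ (fun _ => norm_nonneg _)
    ?_ hb (fun p => by positivity) ?_)
  · simp
  · rw [LSeries_term_one isMultiplicative_reducedArith, norm_one]
  · intro m n h
    rw [LSeries_term_mul isMultiplicative_reducedArith s h, norm_mul]
  · intro p hp
    simp only [hf p _ hp]
    exact (heval p hp).summable
  · intro p hp
    simp only [hf p _ hp]
    refine (heval p hp).norm_le.trans ?_
    have e1 := pow_mul_rpow_neg_pow hp 1 2 σ
    have e2 := pow_mul_rpow_neg_pow hp 5 6 σ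
    have e3 := pow_mul_rpow_neg_pow hp 4 4 σ
    have e4 := pow_mul_rpow_neg_pow hp 3 3 σ
    simp only [pow_one, Nat.cast_ofNat, Nat.cast_one] at e1 e2 e3 e4
    rw [norm_prime_cpow_neg hp, e1, e2, e3, e4]
    have n1 := Real.rpow_nonneg (Nat.cast_nonneg (α := ℝ) p) (1 - 2 * σ)
    have n2 := Real.rpow_nonneg (Nat.cast_nonneg (α := ℝ) p) (5 - 6 * σ)
    have n3 := Real.rpow_nonneg (Nat.cast_nonneg (α := ℝ) p) (4 - 4 * σ)
    have n4 := Real.rpow_nonneg (Nat.cast_nonneg (α := ℝ) p) (3 - 3 * σ)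
    have n5 := Real.rpow_nonneg (Nat.cast_nonneg (α := ℝ) p) (-σ)
    have h2 := rpow_le_half hp (τ := 5 - 6 * σ) (by linarith)
    have h3 := rpow_le_half hp (τ := 4 - 4 * σ) (by linarith)
    have h4 := rpow_le_half hp (τ := 3 - 3 * σ) (by linarith)
    have h5 := rpow_le_half hp (τ := -σ) (by linarith)
    simp only [b, Real.exp_add]
    have i2 : 0 ≤ (1 - (p : ℝ) ^ (5 - 6 * σ))⁻¹ := inv_nonneg.2 (by linarith)
    have i3 : 0 ≤ (1 - (p : ℝ) ^ (4 - 4 * σ))⁻¹ := inv_nonneg.2 (by linarith)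
    have i4 : 0 ≤ (1 - (p : ℝ) ^ (3 - 3 * σ))⁻¹ := inv_nonneg.2 (by linarith)
    have i5 : 0 ≤ (1 - (p : ℝ) ^ (-σ))⁻¹ := inv_nonneg.2 (by linarith)
    gcongr
    · rw [add_comm]
      exact Real.add_one_le_exp _
    · exact inv_one_sub_le_exp n2 h2
    · exact inv_one_sub_le_exp n3 h3
    · exact inv_one_sub_le_exp n4 h4
    · exact inv_one_sub_le_exp n5 h5

theorem hasProd_reducedFactor {s : ℂ} (hs : 4 / 3 < s.re) :
    HasProd (fun p : Nat.Primes => reducedFactor p ((p : ℂ) ^ (-s))) (LSeries reducedArith s) := by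
  have h := EulerProduct.eulerProduct_hasProd (f := LSeries.term reducedArith s)
    (LSeries_term_one isMultiplicative_reducedArith s)
    (fun {m n} h => LSeries_term_mul isMultiplicative_reducedArith s h)
    (LSeriesSummable_reducedArith hs).norm (LSeries.term_zero _ _)
  rw [LSeries]
  convert h using 2 with p
  have h1 := norm_prime_cpow_neg_lt_one p.2 (s := s) (by linarith)
  rw [← (absEval_reducedSeries h1.1 h1.2).tsum_eq]
  refine tsum_congr fun l => ?_
  rw [LSeries_term_prime_pow p.2, reducedArith_prime_pow p.2]

theorem subringZetaLocalTerm_eq {p : ℕ} (hp : p.Prime) (s : ℂ) (l : ℕ) :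
    subringZetaLocalTerm ZtModT4 p s l =
      PowerSeries.coeff l (localSeries ℂ p) * ((p : ℂ) ^ (-s)) ^ l := by
  rw [subringZetaLocalTerm, natCast_pow_cpow, localSeries, PowerSeries.coeff_mk,
    subringArith_apply (pow_ne_zero l hp.ne_zero), Complex.cpow_neg, inv_pow, div_eq_mul_inv]

theorem summable_subringZetaLocalTerm {p : ℕ} (hp : p.Prime) {s : ℂ} (hs : 1 < s.re) :
    Summable (subringZetaLocalTerm ZtModT4 p s) := by
  have h := norm_prime_cpow_neg_lt_one hp hs
  obtain ⟨M, hM⟩ := absEval_localSeries hp h.1 h.2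
  exact hM.summable.of_norm.congr fun l => (subringZetaLocalTerm_eq hp s l).symm

theorem subringZetaLocal_eq {p : ℕ} (hp : p.Prime) {s : ℂ} (hs : 1 < s.re) :
    subringZetaLocal ZtModT4 p s =
      localNumerator (valTwo p) (p : ℂ) ((p : ℂ) ^ (-s)) /
        localDenominator (p : ℂ) ((p : ℂ) ^ (-s)) := by
  have h := norm_prime_cpow_neg_lt_one hp hs
  obtain ⟨M, hM⟩ := absEval_localSeries hp h.1 h.2
  rw [subringZetaLocal]
  simp only [subringZetaLocalTerm_eq hp]
  rw [hM.tsum_eq, reducedFactor, localDenominator]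
  simp only [div_eq_mul_inv, mul_inv]
  ring

theorem LSeries_term_subringCount (s : ℂ) :
    LSeries.term (fun k => (subringCount ZtModT4 k : ℂ)) s =
      LSeries.term ((subringArith : ArithmeticFunction ℂ)) s := by
  refine funext (LSeries.term_congr (fun {k} hk => ?_) s)
  rw [ArithmeticFunction.natCoe_apply, subringArith_apply hk]

theorem LSeriesSummable_subringArith {s : ℂ} (hs : 3 / 2 < s.re) :
    LSeriesSummable (subringArith : ArithmeticFunction ℂ) s := by
  rw [subringArith_eq_mul]
  exact ArithmeticFunction.LSeriesSummable_mul (hasSum_squareArith hs).LSeriesSummable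
    (LSeriesSummable_reducedArith (by linarith))

theorem LSeriesSummable_subringCount {s : ℂ} (hs : 3 / 2 < s.re) :
    LSeriesSummable (fun k => (subringCount ZtModT4 k : ℂ)) s := by
  rw [LSeriesSummable, LSeries_term_subringCount]
  exact LSeriesSummable_subringArith hs

theorem subringZeta_eq {s : ℂ} (hs : 3 / 2 < s.re) :
    subringZeta ZtModT4 s = riemannZeta (2 * s - 2) * LSeries reducedArith s := by
  rw [subringZeta, LSeries, LSeries_term_subringCount, ← LSeries, subringArith_eq_mul,
    ArithmeticFunction.LSeries_mul' (hasSum_squareArith hs).LSeriesSummable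
      (LSeriesSummable_reducedArith (by linarith)), (hasSum_squareArith hs).LSeries_eq]

theorem hasProd_subringZetaLocal {s : ℂ} (hs : 3 / 2 < s.re) :
    HasProd (fun p : Nat.Primes => subringZetaLocal ZtModT4 p s) (subringZeta ZtModT4 s) := by
  have hm := isMultiplicative_subringArith.natCast (R := ℂ)
  have h := EulerProduct.eulerProduct_hasProd
    (f := LSeries.term (subringArith : ArithmeticFunction ℂ) s)
    (LSeries_term_one hm s) (fun {m n} h => LSeries_term_mul hm s h)
    (LSeriesSummable_subringArith hs).norm (LSeries.term_zero _ _)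
  rw [subringZeta, LSeries, LSeries_term_subringCount]
  convert h using 2 with p
  refine tsum_congr fun l => ?_
  rw [subringZetaLocalTerm_eq p.2, LSeries_term_prime_pow p.2, localSeries, PowerSeries.coeff_mk,
    ArithmeticFunction.natCoe_apply]

end ZtModT4

/-! ### The continuation past `Re s = 3/2` -/

namespace ZtModT4

open Filter Topology

theorem differentiableOn_LSeries_reducedArith :
    DifferentiableOn ℂ (LSeries reducedArith) {s | 4 / 3 < s.re} := by
  refine (LSeries_differentiableOn _).mono fun s hs => ?_
  have h : LSeries.abscissaOfAbsConv reducedArith ≤ ((4 / 3 : ℝ) : EReal) :=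
    LSeries.abscissaOfAbsConv_le_of_forall_lt_LSeriesSummable fun y hy =>
      LSeriesSummable_reducedArith (by simpa using hy)
  exact h.trans_lt (EReal.coe_lt_coe_iff.2 hs)

theorem two_mul_sub_two_ne_one {s : ℂ} (h : s ≠ 3 / 2) : 2 * s - 2 ≠ 1 := by
  intro h1
  exact h (by linear_combination h1 / 2)

/-- The continuation of the subring zeta function to `Re s > 4/3`. Its value at the pole `3/2` is
irrelevant. -/
noncomputable def zetaContinuation (s : ℂ) : ℂ := riemannZeta (2 * s - 2) * LSeries reducedArith s

theorem differentiableOn_zetaContinuation :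
    DifferentiableOn ℂ zetaContinuation ({s | 4 / 3 < s.re} \ {3 / 2}) := by
  refine DifferentiableOn.mul (fun s hs => ?_) (differentiableOn_LSeries_reducedArith.mono
    Set.sdiff_subset)
  have h1 := differentiableAt_riemannZeta (two_mul_sub_two_ne_one hs.2)
  exact (h1.comp s (by fun_prop : DifferentiableAt ℂ (fun s : ℂ => 2 * s - 2)
    s)).differentiableWithinAt

theorem meromorphicOrderAt_zetaContinuation (h0 : LSeries reducedArith (3 / 2) ≠ 0) :
    meromorphicOrderAt zetaContinuation (3 / 2) = -1 := by
  -- `(s - 3/2) ζ(2 s - 2)` with its removable singularity filled in: `ζ` has residue `1`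
  -- at `1`
  let z : ℂ → ℂ := Function.update (fun s => (s - 3 / 2) * riemannZeta (2 * s - 2)) (3 / 2) (1 / 2)
  have hne : ∀ᶠ s : ℂ in 𝓝[≠] (3 / 2), s ≠ 3 / 2 := eventually_mem_nhdsWithin
  have hz : AnalyticAt ℂ z (3 / 2) := by
    refine Complex.analyticAt_of_differentiable_on_punctured_nhds_of_continuousAt ?_ ?_
    · filter_upwards [hne] with s hs
      have h1 := (differentiableAt_riemannZeta (two_mul_sub_two_ne_one hs)).comp s
        (by fun_prop : DifferentiableAt ℂ (fun s : ℂ => 2 * s - 2) s)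
      have h2 : DifferentiableAt ℂ (fun s => (s - 3 / 2) * riemannZeta (2 * s - 2)) s :=
        DifferentiableAt.mul (by fun_prop) h1
      refine h2.congr_of_eventuallyEq ?_
      filter_upwards [isOpen_ne.mem_nhds hs] with w hw
      exact Function.update_of_ne hw _ _
    · rw [continuousAt_update_same]
      have h1 : Tendsto (fun s : ℂ => 2 * s - 2) (𝓝[≠] (3 / 2)) (𝓝[≠] 1) := by
        refine tendsto_nhdsWithin_iff.2 ⟨?_, ?_⟩
        · have : Tendsto (fun s : ℂ => 2 * s - 2) (𝓝 (3 / 2)) (𝓝 (2 * (3 / 2) - 2)) :=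
            Continuous.tendsto (by fun_prop) _
          rw [show (2 * (3 / 2) - 2 : ℂ) = 1 by norm_num] at this
          exact this.mono_left nhdsWithin_le_nhds
        · filter_upwards [hne] with s hs
          exact two_mul_sub_two_ne_one hs
      have h2 := (riemannZeta_residue_one.comp h1).const_mul (1 / 2)
      rw [mul_one] at h2
      refine h2.congr fun s => ?_
      simp only [Function.comp]
      ring
  have hL : AnalyticAt ℂ (LSeries reducedArith) (3 / 2) := by
    refine differentiableOn_LSeries_reducedArith.analyticAt
      ((isOpen_lt continuous_const Complex.continuous_re).mem_nhds ?_)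
    norm_num
  have heq : ∀ᶠ s in 𝓝[≠] (3 / 2 : ℂ), zetaContinuation s =
      (s - 3 / 2) ^ (-1 : ℤ) • (z s * LSeries reducedArith s) := by
    filter_upwards [hne] with s hs
    have h1 : z s = (s - 3 / 2) * riemannZeta (2 * s - 2) := Function.update_of_ne hs _ _
    rw [h1, zetaContinuation, zpow_neg_one, smul_eq_mul, mul_assoc, inv_mul_cancel_left₀]
    exact sub_ne_zero.2 hs
  have hmer : MeromorphicAt zetaContinuation (3 / 2) := by
    have h1 : MeromorphicAt (fun s : ℂ => (s - 3 / 2) ^ (-1 : ℤ) • (z s * LSeries reducedArith s))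
        (3 / 2) := by
      have h2 : AnalyticAt ℂ (fun s : ℂ => s - 3 / 2) (3 / 2) := by fun_prop
      exact (h2.meromorphicAt.zpow _).smul (hz.mul hL).meromorphicAt
    refine h1.congr ?_
    filter_upwards [heq] with s hs using hs.symm
  have := (meromorphicOrderAt_eq_int_iff (n := -1) hmer).2
    ⟨fun s => z s * LSeries reducedArith s, hz.mul hL, ?_, heq⟩
  · exact_mod_cast this
  · simp only [z, Function.update_self]
    exact mul_ne_zero (by norm_num) h0

/-! ### Counting subrings of bounded index -/

theorem sum_Ioc_squareArith (M : ℕ) : ∑ m ∈ Finset.Ioc 0 M, squareArith m =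
    ∑ j ∈ Finset.range (M.sqrt + 1), (j : ℂ) ^ 2 := by
  have h1 : ∑ m ∈ (Finset.Ioc 0 M).filter IsSquare, squareArith m =
      ∑ m ∈ Finset.Ioc 0 M, squareArith m := by
    refine Finset.sum_filter_of_ne fun m _ hm => ?_
    by_contra h
    exact hm (by simp [squareArith, h])
  have h2 : ∑ j ∈ Finset.range (M.sqrt + 1), (j : ℂ) ^ 2 =
      ∑ j ∈ (Finset.range (M.sqrt + 1)).filter (0 < ·), (j : ℂ) ^ 2 := by
    refine (Finset.sum_filter_of_ne fun j _ hj => ?_).symm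
    refine Nat.pos_of_ne_zero fun h => hj ?_
    rw [h]
    simp
  rw [← h1, h2]
  symm
  refine Finset.sum_bij (fun j _ => j ^ 2) ?_ ?_ ?_ ?_
  · intro j hj
    simp only [Finset.mem_filter, Finset.mem_range, Finset.mem_Ioc] at hj ⊢
    exact ⟨⟨by have := hj.2; positivity, Nat.le_sqrt'.1 (by omega)⟩, IsSquare.sq j⟩
  · intro j _ j' _ h
    exact Nat.pow_left_injective (n := 2) (by norm_num) h
  · intro m hm
    simp only [Finset.mem_filter, Finset.mem_Ioc] at hm
    obtain ⟨⟨h3, h4⟩, r, rfl⟩ := hm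
    refine ⟨r, ?_, sq r⟩
    simp only [Finset.mem_filter, Finset.mem_range]
    exact ⟨Nat.lt_succ_of_le (Nat.le_sqrt.2 h4), Nat.pos_of_ne_zero (by rintro rfl; simp at h3)⟩
  · intro j _
    exact (squareArith_sq j).symm

/-- The sum of the squares `m² ≤ y`, in closed form. -/
noncomputable def squareSum (y : ℝ) : ℝ :=
  (⌊√y⌋₊ : ℝ) * (⌊√y⌋₊ + 1) * (2 * ⌊√y⌋₊ + 1) / 6

theorem sum_Ioc_floor_squareArith {y : ℝ} (hy : 0 ≤ y) :
    ∑ m ∈ Finset.Ioc 0 ⌊y⌋₊, squareArith m = (squareSum y : ℂ) := by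
  have h1 : Nat.sqrt ⌊y⌋₊ = ⌊√y⌋₊ := by
    symm
    rw [Nat.floor_eq_iff (Real.sqrt_nonneg y)]
    constructor
    · refine Real.le_sqrt_of_sq_le ?_
      refine le_trans ?_ (Nat.floor_le hy)
      exact_mod_cast Nat.sqrt_le' ⌊y⌋₊
    · rw [Real.sqrt_lt' (by positivity)]
      have := (Nat.floor_lt hy).1 (Nat.lt_succ_sqrt' ⌊y⌋₊)
      exact_mod_cast this
  have h2 : ∀ n : ℕ, ∑ j ∈ Finset.range (n + 1), (j : ℂ) ^ 2 =
      (n : ℂ) * (n + 1) * (2 * n + 1) / 6 := by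
    intro n
    induction n with
    | zero => simp
    | succ n ih =>
      rw [Finset.sum_range_succ, ih]
      push_cast
      ring
  rw [sum_Ioc_squareArith, h1, h2, squareSum]
  push_cast
  rfl

theorem rpow_three_halves {y : ℝ} (hy : 0 ≤ y) : y ^ (3 / 2 : ℝ) = √y ^ 3 := by
  rw [Real.sqrt_eq_rpow, ← Real.rpow_natCast, ← Real.rpow_mul hy]
  norm_num

theorem squareSum_nonneg (y : ℝ) : 0 ≤ squareSum y := by
  rw [squareSum]
  positivity

theorem squareSum_le {y : ℝ} (hy : 0 ≤ y) : squareSum y ≤ y ^ (3 / 2 : ℝ) := by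
  rw [rpow_three_halves hy]
  have h1 : (⌊√y⌋₊ : ℝ) ≤ √y := Nat.floor_le (Real.sqrt_nonneg y)
  refine le_trans ?_ (pow_le_pow_left₀ (Nat.cast_nonneg _) h1 3)
  rw [squareSum]
  rcases Nat.eq_zero_or_pos ⌊√y⌋₊ with h | h
  · simp [h]
  · have h2 : (1 : ℝ) ≤ (⌊√y⌋₊ : ℝ) := by exact_mod_cast h
    generalize (⌊√y⌋₊ : ℝ) = u at h2
    nlinarith [mul_nonneg (by linarith : (0 : ℝ) ≤ u) (by nlinarith : 0 ≤ (u - 1) * (4 * u + 1))]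

theorem tendsto_squareSum_div :
    Tendsto (fun y : ℝ => squareSum y / y ^ (3 / 2 : ℝ)) atTop (𝓝 (1 / 3)) := by
  have h1 : Tendsto (fun y : ℝ => (⌊√y⌋₊ : ℝ) / √y) atTop (𝓝 1) :=
    (tendsto_nat_floor_div_atTop (R := ℝ)).comp Real.tendsto_sqrt_atTop
  have h2 : Tendsto (fun y : ℝ => (√y)⁻¹) atTop (𝓝 0) :=
    tendsto_inv_atTop_zero.comp Real.tendsto_sqrt_atTop
  have h3 := ((h1.mul (h1.add h2)).mul ((h1.const_mul 2).add h2)).div_const 6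
  rw [show (1 * (1 + 0) * (2 * 1 + 0) / 6 : ℝ) = 1 / 3 by norm_num] at h3
  refine h3.congr' ?_
  filter_upwards [eventually_gt_atTop 0] with y hy
  have hy' : √y ≠ 0 := (Real.sqrt_pos.2 hy).ne'
  rw [rpow_three_halves hy.le, squareSum]
  field_simp

theorem subringCountUpTo_eq {B : ℝ} (hB : 0 ≤ B) : (subringCountUpTo ZtModT4 B : ℂ) =
    ∑ n ∈ Finset.Ioc 0 ⌊B⌋₊, reducedArith n * (squareSum (B / n) : ℂ) := by
  have h1 : (subringCountUpTo ZtModT4 B : ℂ) =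
      ∑ k ∈ Finset.Ioc 0 ⌊B⌋₊, (reducedArith * squareArith) k := by
    rw [mul_comm, ← subringArith_eq_mul, subringCountUpTo, Nat.cast_sum]
    refine Finset.sum_congr rfl fun k hk => ?_
    rw [ArithmeticFunction.natCoe_apply, subringArith_apply]
    have := (Finset.mem_Ioc.1 hk).1
    omega
  rw [h1, ArithmeticFunction.sum_Ioc_mul_eq_sum_sum]
  refine Finset.sum_congr rfl fun n _ => ?_
  rw [← Nat.floor_div_natCast, sum_Ioc_floor_squareArith (by positivity)]

/-- Dominated convergence in `∑ reducedArith(n) squareSum(B / n) / B ^ (3/2)`: each term tends to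
`reducedArith(n) n ^ (-3/2) / 3` and is dominated by `‖reducedArith(n)‖ n ^ (-3/2)`. -/
theorem tendsto_subringCountUpTo_div :
    Tendsto (fun B : ℝ => (subringCountUpTo ZtModT4 B : ℂ) / ((B ^ (3 / 2 : ℝ) : ℝ) : ℂ)) atTop
      (𝓝 (LSeries reducedArith (3 / 2) / 3)) := by
  have hsum : LSeriesSummable reducedArith (3 / 2) := LSeriesSummable_reducedArith (by norm_num)
  let f : ℝ → ℕ → ℂ := fun B n => reducedArith n *
    ((if n ≤ ⌊B⌋₊ then squareSum (B / n) / B ^ (3 / 2 : ℝ) else 0 : ℝ) : ℂ)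
  have hdiv : ∀ {B : ℝ} {n : ℕ}, 0 ≤ B →
      (B / n) ^ (3 / 2 : ℝ) = B ^ (3 / 2 : ℝ) / (n : ℝ) ^ (3 / 2 : ℝ) := fun hB =>
    Real.div_rpow hB (Nat.cast_nonneg _) _
  have hcpow : ∀ n : ℕ, (n : ℂ) ^ (3 / 2 : ℂ) = (((n : ℝ) ^ (3 / 2 : ℝ) : ℝ) : ℂ) := fun n => by
    rw [Complex.ofReal_cpow (Nat.cast_nonneg n)]
    norm_num
  have hlim := tendsto_tsum_of_dominated_convergence (𝓕 := atTop) (f := f)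
    (g := fun n => LSeries.term reducedArith (3 / 2) n / 3) hsum.norm ?_ ?_
  · rw [tsum_div_const] at hlim
    refine hlim.congr' ?_
    filter_upwards [eventually_ge_atTop 0] with B hB
    rw [subringCountUpTo_eq hB, Finset.sum_div, tsum_eq_sum (s := Finset.Ioc 0 ⌊B⌋₊)]
    · refine Finset.sum_congr rfl fun n hn => ?_
      simp only [f, if_pos (Finset.mem_Ioc.1 hn).2]
      push_cast
      rw [mul_div_assoc]
    · intro n hn
      rcases Nat.eq_zero_or_pos n with rfl | hn0
      · simp [f]
      · have : ¬ n ≤ ⌊B⌋₊ := fun h => hn (Finset.mem_Ioc.2 ⟨hn0, h⟩)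
        simp [f, this]
  · intro n
    rcases Nat.eq_zero_or_pos n with rfl | hn0
    · simp [f]
    have hn : (0 : ℝ) < n := Nat.cast_pos.2 hn0
    have h1 : Tendsto (fun B : ℝ => squareSum (B / n) / (B / n) ^ (3 / 2 : ℝ)) atTop (𝓝 (1 / 3)) :=
      tendsto_squareSum_div.comp (tendsto_id.atTop_div_const hn)
    have h2 := ((Complex.continuous_ofReal.tendsto _).comp
      (h1.div_const ((n : ℝ) ^ (3 / 2 : ℝ)))).const_mul (reducedArith n)
    have h3 : reducedArith n * ((1 / 3 / (n : ℝ) ^ (3 / 2 : ℝ) : ℝ) : ℂ) =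
        LSeries.term reducedArith (3 / 2) n / 3 := by
      rw [LSeries.term_def, if_neg hn0.ne', hcpow]
      push_cast
      ring
    rw [h3] at h2
    refine h2.congr' ?_
    filter_upwards [eventually_ge_atTop (n : ℝ)] with B hB
    have hB0 : 0 < B := hn.trans_le hB
    have h4 : (0 : ℝ) < (n : ℝ) ^ (3 / 2 : ℝ) := Real.rpow_pos_of_pos hn _
    have h5 : (0 : ℝ) < B ^ (3 / 2 : ℝ) := Real.rpow_pos_of_pos hB0 _
    simp only [f, Function.comp, if_pos (Nat.le_floor hB)]
    rw [hdiv hB0.le]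
    congr 2
    field_simp
  · filter_upwards [eventually_gt_atTop 0] with B hB n
    rcases Nat.eq_zero_or_pos n with rfl | hn0
    · simp [f]
    have hn : (0 : ℝ) < n := Nat.cast_pos.2 hn0
    have h4 : (0 : ℝ) < (n : ℝ) ^ (3 / 2 : ℝ) := Real.rpow_pos_of_pos hn _
    have h5 : (0 : ℝ) < B ^ (3 / 2 : ℝ) := Real.rpow_pos_of_pos hB _
    rw [LSeries.term_def, if_neg hn0.ne', hcpow, norm_mul, norm_div, Complex.norm_real,
      Complex.norm_real, Real.norm_of_nonneg h4.le,
      div_eq_mul_inv ‖reducedArith n‖]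
    refine mul_le_mul_of_nonneg_left ?_ (norm_nonneg _)
    split_ifs
    · rw [Real.norm_of_nonneg (div_nonneg (squareSum_nonneg _) h5.le), div_le_iff₀ h5]
      refine (squareSum_le (by positivity)).trans (le_of_eq ?_)
      rw [hdiv hB.le]
      ring
    · rw [norm_zero]
      positivity

end ZtModT4

/-! ### The leading constant -/

namespace ZtModT4

open Filter Topology

theorem pow_mul_cpow_neg_pow {p : ℕ} (hp : p.Prime) (a k : ℕ) (s : ℂ) :
    (p : ℂ) ^ a * ((p : ℂ) ^ (-s)) ^ k = (p : ℂ) ^ (-(k * s - a)) := by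
  have hp0 : (p : ℂ) ≠ 0 := Nat.cast_ne_zero.2 hp.ne_zero
  rw [← Complex.cpow_natCast, ← Complex.cpow_nat_mul, ← Complex.cpow_add _ _ hp0]
  congr 1
  ring

theorem hasProd_inv_one_sub (a k : ℕ) {s : ℂ} (hs : 1 < (k * s - a).re) :
    HasProd (fun p : Nat.Primes => (1 - (p : ℂ) ^ a * ((p : ℂ) ^ (-s)) ^ k)⁻¹)
      (riemannZeta (k * s - a)) := by
  convert riemannZeta_eulerProduct_hasProd hs using 4 with p
  exact pow_mul_cpow_neg_pow p.2 a k s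

theorem localNumerator_odd {p : ℕ} (hp : p.Prime) (hp2 : p ≠ 2) :
    localNumerator (valTwo p) (p : ℝ) ((p : ℝ) ^ (-(3 / 2) : ℝ)) = constantFactor p := by
  have h := pow_mul_rpow_neg_pow hp
  simp only [localNumerator, valTwo, if_neg hp2, if_true]
  have h1 := h 1 2 (3 / 2)
  have h2 := h 2 3 (3 / 2)
  have h3 := h 4 5 (3 / 2)
  have h4 := h 5 6 (3 / 2)
  have h5 := h 6 7 (3 / 2)
  have h6 := h 7 8 (3 / 2)
  have h7 := h 9 10 (3 / 2)
  have h8 := h 10 11 (3 / 2)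
  have h9 := h 11 13 (3 / 2)
  norm_num at h1 h2 h3 h4 h5 h6 h7 h8 h9
  norm_num [constantFactor, mul_assoc, h1, h2, h3, h4, h5, h6, h7, h8, h9]

/-- The factor `3` is compensated by the `1/3` in the asymptotics of the sum of squares. -/
theorem localNumerator_two :
    localNumerator (valTwo 2) (2 : ℝ) ((2 : ℝ) ^ (-(3 / 2) : ℝ)) = 3 * ((314 - 5 * √2) / 768) := by
  have h1 : (2 : ℝ) ^ (-(3 / 2) : ℝ) = √2 / 4 := by
    rw [Real.rpow_neg (by norm_num), rpow_three_halves (by norm_num)]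
    have h2 : √2 ^ 2 = (2 : ℝ) := Real.sq_sqrt (by norm_num)
    have h3 : √2 ≠ 0 := by positivity
    field_simp
    linear_combination (-2 - √2 ^ 2) * h2
  have h2 : √2 ^ 2 = (2 : ℝ) := Real.sq_sqrt (by norm_num)
  rw [h1]
  simp only [localNumerator, valTwo, if_true, if_neg one_ne_zero]
  generalize √2 = r at h2
  have e3 : r ^ 3 = 2 * r := by linear_combination r * h2
  have e5 : r ^ 5 = 4 * r := by linear_combination r ^ 3 * h2 + 2 * e3
  have e7 : r ^ 7 = 8 * r := by linear_combination r ^ 5 * h2 + 2 * e5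
  have e8 : r ^ 8 = 16 := by linear_combination r * e7 + 8 * h2
  have e10 : r ^ 10 = 32 := by linear_combination r ^ 2 * e8 + 16 * h2
  have e11 : r ^ 11 = 32 * r := by linear_combination r * e10
  have e12 : r ^ 12 = 64 := by linear_combination r * e11 + 32 * h2
  have e13 : r ^ 13 = 64 * r := by linear_combination r * e12
  simp only [div_pow, h2, e3, e5, e7, e8, e10, e11, e12, e13]
  ring

theorem multipliable_constantFactor :
    Multipliable (fun p : {p : Nat.Primes // (p : ℕ) ≠ 2} => constantFactor ((p : ℕ) : ℝ)) := by
  have h1 : Summable fun n : ℕ => constantFactor n - 1 := by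
    have h : ∀ {a : ℝ}, a < -1 → Summable fun n : ℕ => (n : ℝ) ^ a := fun ha =>
      Real.summable_nat_rpow.2 ha
    refine (((((((((h (a := -2) (by norm_num)).add (h (a := -(5 / 2)) (by norm_num))).sub
      (h (a := -(7 / 2)) (by norm_num))).sub ((h (a := -4) (by norm_num)).mul_left 2)).sub
      ((h (a := -(9 / 2)) (by norm_num)).mul_left 2)).sub (h (a := -5) (by norm_num))).add
      (h (a := -6) (by norm_num))).add (h (a := -(13 / 2)) (by norm_num))).add
      (h (a := -(17 / 2)) (by norm_num))).congr fun n => ?_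
    rw [constantFactor]
    ring
  have hinj : Function.Injective fun p : {p : Nat.Primes // (p : ℕ) ≠ 2} => (p : ℕ) :=
    fun p q h => Subtype.ext (Subtype.ext h)
  exact (Real.multipliable_one_add_of_summable (h1.comp_injective hinj)).congr fun p => by
    simp only [Function.comp]
    ring

theorem one_le_constantFactor {x : ℝ} (hx : 3 ≤ x) : 1 ≤ constantFactor x := by
  have hx0 : 0 < x := by linarith
  have hx1 : 1 ≤ x := by linarith
  have m : ∀ {a b : ℝ}, a ≤ b → x ^ a ≤ x ^ b := fun h => Real.rpow_le_rpow_of_exponent_le hx1 h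
  have h1 := m (show (-(7 / 2) : ℝ) ≤ -(5 / 2) by norm_num)
  have h2 := m (show (-(9 / 2) : ℝ) ≤ -4 by norm_num)
  have h3 := m (show (-5 : ℝ) ≤ -4 by norm_num)
  -- after `-x ^ (-7/2)` is absorbed by `x ^ (-5/2)`, the other negative terms amount to at most
  -- `5 x ^ (-4)`
  have h4 : 5 * x ^ (-4 : ℝ) ≤ x ^ (-2 : ℝ) := by
    have h5 : x ^ (-2 : ℝ) = x ^ (-4 : ℝ) * x ^ 2 := by
      rw [← Real.rpow_natCast, ← Real.rpow_add hx0]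
      norm_num
    rw [h5, mul_comm]
    exact mul_le_mul_of_nonneg_left (by nlinarith) (Real.rpow_nonneg hx0.le _)
  have n1 := Real.rpow_nonneg hx0.le (-6)
  have n2 := Real.rpow_nonneg hx0.le (-(13 / 2))
  have n3 := Real.rpow_nonneg hx0.le (-(17 / 2))
  rw [constantFactor]
  linarith

theorem one_le_tprod_constantFactor :
    1 ≤ ∏' p : {p : Nat.Primes // (p : ℕ) ≠ 2}, constantFactor ((p : ℕ) : ℝ) := by
  refine ge_of_tendsto' multipliable_constantFactor.hasProd fun u => ?_
  refine Finset.prod_const_one.symm.trans_le (Finset.prod_le_prod (s := u)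
    (fun _ _ => zero_le_one) fun p _ => one_le_constantFactor ?_)
  have h1 := p.1.2.two_le
  have h2 := p.2
  have h3 : 3 ≤ (p : ℕ) := by omega
  exact_mod_cast h3

theorem hasProd_localNumerator :
    HasProd (fun p : Nat.Primes => localNumerator (valTwo p) (p : ℝ) ((p : ℝ) ^ (-(3 / 2) : ℝ)))
      (3 * ((314 - 5 * √2) / 768) *
        ∏' p : {p : Nat.Primes // (p : ℕ) ≠ 2}, constantFactor ((p : ℕ) : ℝ)) := by
  set q : Nat.Primes := ⟨2, Nat.prime_two⟩
  have h1 : HasProd ((fun p : Nat.Primes => localNumerator (valTwo p) (p : ℝ)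
      ((p : ℝ) ^ (-(3 / 2) : ℝ))) ∘ ((↑) : ({q} : Set Nat.Primes) → Nat.Primes))
      (3 * ((314 - 5 * √2) / 768)) := by
    rw [← localNumerator_two]
    exact hasProd_unique _
  have h2 : HasProd ((fun p : Nat.Primes => localNumerator (valTwo p) (p : ℝ)
      ((p : ℝ) ^ (-(3 / 2) : ℝ))) ∘ ((↑) : {p : Nat.Primes | (p : ℕ) ≠ 2} → Nat.Primes))
      (∏' p : {p : Nat.Primes // (p : ℕ) ≠ 2}, constantFactor ((p : ℕ) : ℝ)) := by
    have h : (fun p : Nat.Primes => localNumerator (valTwo p) (p : ℝ) ((p : ℝ) ^ (-(3 / 2) : ℝ))) ∘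
        ((↑) : {p : Nat.Primes | (p : ℕ) ≠ 2} → Nat.Primes) =
        fun p : {p : Nat.Primes | (p : ℕ) ≠ 2} => constantFactor (((p : Nat.Primes) : ℕ) : ℝ) :=
      funext fun p => localNumerator_odd p.1.2 p.2
    rw [h]
    exact multipliable_constantFactor.hasProd
  refine h1.mul_isCompl ?_ h2
  have h3 : {p : Nat.Primes | (p : ℕ) ≠ 2} = ({q} : Set Nat.Primes)ᶜ := by
    ext p
    simp only [Set.mem_ofPred_eq, Set.mem_compl_iff, Set.mem_singleton_iff, ne_eq]
    exact not_congr ⟨fun h => Subtype.ext h, fun h => congrArg Subtype.val h⟩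
  rw [h3]
  exact isCompl_compl

theorem LSeries_reducedArith_eq : LSeries reducedArith (3 / 2) =
    ((3 * ((314 - 5 * √2) / 768) *
        ∏' p : {p : Nat.Primes // (p : ℕ) ≠ 2}, constantFactor ((p : ℕ) : ℝ) : ℝ) : ℂ) *
      riemannZeta 4 * riemannZeta 2 * riemannZeta (3 / 2) * riemannZeta (3 / 2) := by
  have h0 := hasProd_localNumerator.map Complex.ofRealHom Complex.continuous_ofReal
  have h1 := hasProd_inv_one_sub 5 6 (s := 3 / 2) (by norm_num)
  have h2 := hasProd_inv_one_sub 4 4 (s := 3 / 2) (by norm_num)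
  have h3 := hasProd_inv_one_sub 3 3 (s := 3 / 2) (by norm_num)
  have h4 := hasProd_inv_one_sub 0 1 (s := 3 / 2) (by norm_num)
  norm_num only [Nat.cast_ofNat, Nat.cast_zero, Nat.cast_one] at h1 h2 h3 h4
  refine (hasProd_reducedFactor (s := 3 / 2) (by norm_num)).unique ?_
  convert (((h0.mul h1).mul h2).mul h3).mul h4 using 1
  · funext p
    have h5 : (p : ℂ) ^ (-(3 / 2 : ℂ)) = (((p : ℝ) ^ (-(3 / 2) : ℝ) : ℝ) : ℂ) := by
      rw [Complex.ofReal_cpow (Nat.cast_nonneg _)]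
      norm_num
    have h6 : localNumerator (valTwo p) (p : ℂ) ((p : ℂ) ^ (-(3 / 2 : ℂ))) = Complex.ofRealHom
        (localNumerator (valTwo p) (p : ℝ) ((p : ℝ) ^ (-(3 / 2) : ℝ))) := by
      rw [h5]
      generalize (p : ℝ) ^ (-(3 / 2) : ℝ) = x
      simp only [localNumerator]
      split_ifs <;> simp
    rw [reducedFactor, h6]
    simp only [Function.comp, pow_zero, one_mul, pow_one]
  · rfl

theorem LSeries_reducedArith_ne_zero : LSeries reducedArith (3 / 2) ≠ 0 := by
  have h1 : 0 < 3 * ((314 - 5 * √2) / 768) *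
      ∏' p : {p : Nat.Primes // (p : ℕ) ≠ 2}, constantFactor ((p : ℕ) : ℝ) := by
    have h2 : √2 < 2 := by
      rw [Real.sqrt_lt' (by norm_num)]
      norm_num
    have h3 := one_le_tprod_constantFactor
    exact mul_pos (by linarith) (by linarith)
  have hz : ∀ {s : ℂ}, 1 ≤ s.re → riemannZeta s ≠ 0 :=
    fun h => riemannZeta_ne_zero_of_one_le_re h
  rw [LSeries_reducedArith_eq]
  refine mul_ne_zero (mul_ne_zero (mul_ne_zero (mul_ne_zero ?_ (hz ?_)) (hz ?_)) (hz ?_)) (hz ?_)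
  · exact Complex.ofReal_ne_zero.2 h1.ne'
  all_goals norm_num

theorem exists_isEquivalent_subringCountUpTo : ∃ C : ℝ, (C : ℂ) = LSeries reducedArith (3 / 2) / 3 ∧
    Asymptotics.IsEquivalent atTop (fun B : ℝ => (subringCountUpTo ZtModT4 B : ℝ))
      (fun B : ℝ => C * B ^ (3 / 2 : ℝ)) := by
  set L := LSeries reducedArith (3 / 2) / 3 with hL
  have hL0 : L ≠ 0 := div_ne_zero LSeries_reducedArith_ne_zero (by norm_num)
  have ht : Tendsto (fun B : ℝ => (((subringCountUpTo ZtModT4 B : ℝ) / B ^ (3 / 2 : ℝ) : ℝ) : ℂ))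
      atTop (𝓝 L) := by
    refine tendsto_subringCountUpTo_div.congr fun B => ?_
    push_cast
    rfl
  have hre : Tendsto (fun B : ℝ => (subringCountUpTo ZtModT4 B : ℝ) / B ^ (3 / 2 : ℝ)) atTop
      (𝓝 L.re) := (Complex.continuous_re.tendsto L).comp ht
  -- a limit of real numbers is real
  have him : (0 : ℝ) = L.im :=
    tendsto_nhds_unique tendsto_const_nhds ((Complex.continuous_im.tendsto L).comp ht)
  have hC : (L.re : ℂ) = L := Complex.ext (by simp) (by simpa using him)
  have hC0 : L.re ≠ 0 := fun h => hL0 (by rw [← hC, h, Complex.ofReal_zero])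
  refine ⟨L.re, hC, ?_⟩
  have h0 : ∀ᶠ B : ℝ in atTop, L.re * B ^ (3 / 2 : ℝ) ≠ 0 := by
    filter_upwards [eventually_gt_atTop 0] with B hB
    exact mul_ne_zero hC0 (Real.rpow_pos_of_pos hB _).ne'
  rw [Asymptotics.isEquivalent_iff_tendsto_one h0]
  have h1 := hre.div_const L.re
  rw [div_self hC0] at h1
  refine h1.congr fun B => ?_
  simp only [Pi.div_apply]
  rw [div_div, mul_comm]

end ZtModT4

theorem theorem1 :
    -- the counts are finite and the series converges for `Re s > 3/2`
    (∀ k : ℕ, k ≠ 0 → (subringsOfIndex ZtModT4 k).Finite) ∧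
    (∀ s : ℂ, 3 / 2 < s.re → LSeriesSummable (fun k => (subringCount ZtModT4 k : ℂ)) s) ∧
    -- Euler product over all primes
    (∀ s : ℂ, 3 / 2 < s.re →
      HasProd (fun p : Nat.Primes => subringZetaLocal ZtModT4 p s) (subringZeta ZtModT4 s)) ∧
    -- local factors at the odd primes
    (∀ p : ℕ, p.Prime → p ≠ 2 → ∀ s : ℂ, 1 < s.re → ∀ x : ℂ, x = (p : ℂ) ^ (-s) →
      Summable (subringZetaLocalTerm ZtModT4 p s) ∧
      subringZetaLocal ZtModT4 p s =
        (1 + p * x ^ 2 + p ^ 2 * x ^ 3 - p ^ 4 * x ^ 5 - 2 * p ^ 5 * x ^ 6 - 2 * p ^ 6 * x ^ 7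
            - p ^ 7 * x ^ 8 + p ^ 9 * x ^ 10 + p ^ 10 * x ^ 11 + p ^ 11 * x ^ 13) /
          ((1 - p ^ 5 * x ^ 6) * (1 - p ^ 4 * x ^ 4) * (1 - p ^ 3 * x ^ 3)
            * (1 - p ^ 2 * x ^ 2) * (1 - x))) ∧
    -- local factor at `2`
    (∀ s : ℂ, 1 < s.re → ∀ x : ℂ, x = (2 : ℂ) ^ (-s) →
      Summable (subringZetaLocalTerm ZtModT4 2 s) ∧
      subringZetaLocal ZtModT4 2 s =
        (1 + 2 * x ^ 2 + 2 ^ 2 * x ^ 3 - 2 ^ 4 * x ^ 5 - (2 ^ 7 + 2 ^ 6) * x ^ 7 - 2 ^ 7 * x ^ 8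
            + 2 ^ 9 * x ^ 10 + 2 ^ 10 * x ^ 11 - 2 ^ 11 * x ^ 12 + 2 ^ 12 * x ^ 13) /
          ((1 - 2 ^ 5 * x ^ 6) * (1 - 2 ^ 4 * x ^ 4) * (1 - 2 ^ 3 * x ^ 3)
            * (1 - 2 ^ 2 * x ^ 2) * (1 - x))) ∧
    -- continuation past `Re s = 3/2`, where the only pole is a simple pole at `3/2`
    (∃ δ : ℝ, 0 < δ ∧ ∃ F : ℂ → ℂ,
      (∀ s : ℂ, 3 / 2 < s.re → F s = subringZeta ZtModT4 s) ∧
      DifferentiableOn ℂ F ({s : ℂ | 3 / 2 - δ < s.re} \ {3 / 2}) ∧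
      meromorphicOrderAt F (3 / 2) = -1) ∧
    -- the number of subrings of index at most `B`
    Multipliable (fun p : {p : Nat.Primes // (p : ℕ) ≠ 2} => constantFactor ((p : ℕ) : ℝ)) ∧
    (∃ C : ℝ,
      (C : ℂ) = (((314 - 5 * Real.sqrt 2) / 768 : ℝ) : ℂ)
        * riemannZeta (3 / 2) ^ 2 * riemannZeta 2 * riemannZeta 4
        * ((∏' p : {p : Nat.Primes // (p : ℕ) ≠ 2}, constantFactor ((p : ℕ) : ℝ) : ℝ) : ℂ) ∧
      Asymptotics.IsEquivalent Filter.atTop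
        (fun B : ℝ => (subringCountUpTo ZtModT4 B : ℝ)) (fun B : ℝ => C * B ^ (3 / 2 : ℝ))) := by
  refine ⟨fun k hk => ZtModT4.finite_subringsOfIndex hk,
    fun s hs => ZtModT4.LSeriesSummable_subringCount hs,
    fun s hs => ZtModT4.hasProd_subringZetaLocal hs, ?_, ?_, ?_,
    ZtModT4.multipliable_constantFactor, ?_⟩
  · rintro p hp hp2 s hs x rfl
    refine ⟨ZtModT4.summable_subringZetaLocalTerm hp hs, ?_⟩
    rw [ZtModT4.subringZetaLocal_eq hp hs, ZtModT4.localDenominator, ZtModT4.localNumerator,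
      ZtModT4.valTwo, if_neg hp2, if_pos rfl]
  · rintro s hs x rfl
    refine ⟨ZtModT4.summable_subringZetaLocalTerm Nat.prime_two hs, ?_⟩
    rw [ZtModT4.subringZetaLocal_eq Nat.prime_two hs, ZtModT4.localDenominator,
      ZtModT4.localNumerator, ZtModT4.valTwo, if_pos rfl, if_neg one_ne_zero, Nat.cast_ofNat]
    congr 1
    -- at `c = 2` the coefficient of `x ^ 6` vanishes
    ring
  · refine ⟨1 / 6, by norm_num, ZtModT4.zetaContinuation,
      fun s hs => (ZtModT4.subringZeta_eq hs).symm, ?_,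
      ZtModT4.meromorphicOrderAt_zetaContinuation ZtModT4.LSeries_reducedArith_ne_zero⟩
    rw [show (3 / 2 - 1 / 6 : ℝ) = 4 / 3 by norm_num]
    exact ZtModT4.differentiableOn_zetaContinuation
  · obtain ⟨C, hC, hasymp⟩ := ZtModT4.exists_isEquivalent_subringCountUpTo
    refine ⟨C, ?_, hasymp⟩
    rw [hC, ZtModT4.LSeries_reducedArith_eq]
    push_cast
    ring
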